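/- **Kruskal–Katona theorem for high dimensional expanders.** Let $k\ge 1$. There is $\epsilon_0=\epsilon_0(k)>0$ such that the following holds for every $0<\epsilon\le\epsilon_0$. Let $X$ be a finite pure $(k-1)$-dimensional simplicial complex; write $X(j)$ for its set of $j$-dimensional faces (faces with $j+1$ vertices, $X(-1)=\{\varnothing\}$), and let $X(k-1)$ carry a probability measure $\mu$ of full support, for instance the uniform measure. For $j<k-1$ the measure $\mu$ on $X(j)$ is the law of a uniformly random $(j+1)$-element subset of a $\mu$-random $\tau\in X(k-1)$. For a face $\sigma$ let $\mu_\sigma$ be $\mu$ on $X(k-1)$ conditioned on $\tau\supseteq\sigma$; the weighted $1$-skeleton of the link of $\sigma$ (where $|\sigma|\le k-2$) is the graph on the vertices $v\notin\sigma$ with $\sigma\cup\{v\}\in X$ in which the edge $\{u,v\}$ has weight $\Pr_{\tau\sim\mu}[\tau\supseteq\sigma\cup\{u,v\}]$. Suppose that $X$ is an $\epsilon$-HDX: for every face $\sigma$ with $|\sigma|\le k-2$ (including $\sigma=\varnothing$), all eigenvalues of the random walk on the weighted $1$-skeleton of the link of $\sigma$, apart from the trivial eigenvalue $1$ belonging to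 the constant functions (counted once), are at most $\epsilon$ in absolute value. Let $d\ge 0$ be an integer, let $\delta\le(200d)^{-d}$ (with $0^0=1$), and let $A\subseteq X(k-1)$ be $(d,\delta)$-global, that is, $$\|1_A\|_{L^2(\mu_\sigma)}=\sqrt{\Pr_{\tau\sim\mu_\sigma}[\tau\in A]}\le\delta\quad\text{for every face }\sigma\text{ of }X\text{ with }|\sigma|\le d .$$ Let $\partial(A)\subseteq X(k-2)$ be the lower shadow of $A$, the set of all $(k-1)$-element sets contained in a member of $A$. Then $$\mu(\partial(A))\ \ge\ \mu(A)\Bigl(1+\frac{d}{2k}\Bigr).$$ -/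

import Mathlib

noncomputable section

/-- A finite weighted pure `(k-1)`-dimensional simplicial complex on the vertex set `V`: every face
is contained in a top-dimensional face (a face with `k` vertices), and the top-dimensional faces
carry a probability measure of full support. For the uniform measure all the weights are equal. -/
structure WeightedComplex (V : Type*) (k : ℕ) extends PreAbstractSimplicialComplex V where
  /-- The set `X(k-1)` of top-dimensional faces. -/
  facets : Finset (Finset V)
  mem_facets : ∀ τ : Finset V, τ ∈ facets ↔ τ ∈ faces ∧ τ.card = k
  pure : ∀ σ ∈ faces, ∃ τ ∈ facets, σ ⊆ τ
  /-- The probability measure on the top-dimensional faces. -/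
  weight : Finset V → ℝ
  weight_pos : ∀ τ ∈ facets, 0 < weight τ
  sum_weight : ∑ τ ∈ facets, weight τ = 1

namespace WeightedComplex

variable {V : Type*} [DecidableEq V] {k : ℕ}

/-- The faces of `X`, including the empty face, which Mathlib's complexes leave out. -/
def IsFace (X : WeightedComplex V k) (σ : Finset V) : Prop :=
  σ = ∅ ∨ σ ∈ X.faces

/-- The probability that a random top-dimensional face contains `σ`. -/
def mass (X : WeightedComplex V k) (σ : Finset V) : ℝ :=
  ∑ τ ∈ X.facets with σ ⊆ τ, X.weight τ

/-- The measure `μ` of a family of faces of one dimension. The measure on the faces with `j`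
vertices is the law of a uniformly random `j`-subset of a random top-dimensional face, so a face
`σ` has measure `X.mass σ / (k choose |σ|)`. -/
def measure (X : WeightedComplex V k) (B : Finset (Finset V)) : ℝ :=
  ∑ σ ∈ B, X.mass σ / (k.choose σ.card : ℝ)

open Classical in
/-- The vertices of the link of `σ`. -/
def linkVertices (X : WeightedComplex V k) (σ : Finset V) : Finset V :=
  {v ∈ X.facets.biUnion id | v ∉ σ ∧ insert v σ ∈ X.faces}

/-- Transition probabilities of the random walk on the weighted `1`-skeleton of the link of `σ`,
where the edge `{u, v}` has weight proportional to the probability that a random top-dimensional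
face contains `σ ∪ {u, v}`. The normalisation is
`∑ v, X.mass (σ ∪ {u, v}) = (k - |σ| - 1) * X.mass (σ ∪ {u})`, the sum being over `v ∉ σ ∪ {u}`. -/
def linkWalk (X : WeightedComplex V k) (σ : Finset V) (u v : V) : ℝ :=
  if u = v then 0
  else X.mass (insert v (insert u σ)) / (((k : ℝ) - σ.card - 1) * X.mass (insert u σ))

/-- `f` is a nonzero eigenfunction, with eigenvalue `r`, of the random walk on the `1`-skeleton of
the link of `σ`, and it is orthogonal to the constants with respect to the stationary measure of
the walk (the probability of a link vertex `v` being proportional to `X.mass (σ ∪ {v})`). -/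
def IsNontrivialEigenfunction (X : WeightedComplex V k) (σ : Finset V) (r : ℝ) (f : V → ℝ) :
    Prop :=
  (∃ v ∈ X.linkVertices σ, f v ≠ 0) ∧
  ∑ v ∈ X.linkVertices σ, X.mass (insert v σ) * f v = 0 ∧
  ∀ u ∈ X.linkVertices σ, ∑ v ∈ X.linkVertices σ, X.linkWalk σ u v * f v = r * f u

/-- `X` is an `ε`-HDX: in the `1`-skeleton of the link of every face with at most `k - 2` vertices
(the empty face included), all the eigenvalues of the random walk apart from the trivial
eigenvalue `1` of the constants are at most `ε` in absolute value. -/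
def IsHDX (X : WeightedComplex V k) (ε : ℝ) : Prop :=
  ∀ σ : Finset V, X.IsFace σ → σ.card + 2 ≤ k →
    ∀ (r : ℝ) (f : V → ℝ), X.IsNontrivialEigenfunction σ r f → |r| ≤ ε

/-- The norm of the restriction of `f : X(k-1) → ℝ` to the link of `σ`, in `L²` of the link, that
is, with respect to the law of a random top-dimensional face conditioned to contain `σ`. -/
def linkNorm (X : WeightedComplex V k) (f : Finset V → ℝ) (σ : Finset V) : ℝ :=
  Real.sqrt (∑ τ ∈ X.facets with σ ⊆ τ, X.weight τ / X.mass σ * f τ ^ 2)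

/-- `f : X(k-1) → ℝ` is `(d, δ)`-global. -/
def IsGlobal (X : WeightedComplex V k) (d : ℕ) (δ : ℝ) (f : Finset V → ℝ) : Prop :=
  ∀ σ : Finset V, X.IsFace σ → σ.card ≤ d → X.linkNorm f σ ≤ δ

/-- The indicator function of a family of faces. -/
def indicator (A : Finset (Finset V)) (τ : Finset V) : ℝ :=
  if τ ∈ A then 1 else 0

end WeightedComplex

end

/-! Order every facet in all `k!` ways. A facet then becomes a point with `k` coordinates, and
forgetting a vertex becomes a conditional expectation. Expansion of the links says that, given any
set of coordinates, two further coordinates are almost uncorrelated. Adding coordinates one at a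
time, `cex S ∘ cex T` is within `k² ε` of `cex (S ∩ T)` in operator norm. So the measure behaves
like a product measure: `f = 1_A` has Efron–Stein components `f_S` that are almost orthogonal, and
every error is at most a quantity of size `C · ε ‖f‖²`, with `C` depending on `k` and on the
auxiliary parameters.

Let `P_i` be the expectation given all positions but `i`. Then `∑ ‖P_i f‖²` is about `∑ (k - |S|)
‖f_S‖²`, hence at most `(k - d) ‖f‖²` once `f` has little weight on degrees at most `d`. A facet of
`A` with its `i`-th vertex removed lies in the shadow, so Cauchy–Schwarz, for each `i` and then over
`i`, gives `k μ(A) ≤ (k - d) μ(∂A)`, which implies the claim.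

The low-degree weight `w` is bounded by a level inequality. With `g` the low-degree part, `E[f g] ≈
w`, and `f = f²` gives `E[f g]² ≤ ‖f‖² E[f g²]`. Expand `g²` into products `f_S f_T`, grouped by `Q
= S ∩ T`. Only the component of `f` at the symmetric difference of `S` and `T`, relative to `Q`,
matters in `E[f f_S f_T]`. A weighted arithmetic-geometric mean inequality separates it from `f_S
f_T`: the squares of such components add up to about `E[f | Q] ≤ δ²`, by globalness, while `f_S²`
and `f_T²` are almost independent given `Q` and add up to at most the square of the influence of
`Q`. A weight proportional to that influence balances both sides at `2^d δ` times the influence, so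
`E[f g²]` is at most about `4^d δ w`. -/

noncomputable section

/-! ### Conditional expectations and `L²` norms on a finite space with coordinates. -/

/-- A finite measure space with all weights positive, equipped with a family of coordinates. -/
structure CoordinateSpace (Ω ι V : Type*) where
  /-- The weight of a point. -/
  prob : Ω → ℝ
  prob_pos : ∀ ω, 0 < prob ω
  /-- The coordinates of a point. -/
  coord : Ω → ι → V

namespace CoordinateSpace

variable {Ω ι V : Type*} (P : CoordinateSpace Ω ι V)

/-- The function `g` depends only on the coordinates in `S`. -/
def Dep (S : Finset ι) (g : Ω → ℝ) : Prop :=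
  ∀ ω ω', (∀ i ∈ S, P.coord ω' i = P.coord ω i) → g ω' = g ω

variable {P}

theorem Dep.mono {S T : Finset ι} (h : S ⊆ T) {g : Ω → ℝ} (hg : P.Dep S g) : P.Dep T g :=
  fun ω ω' hω => hg ω ω' fun i hi => hω i (h hi)

theorem Dep.mul {S : Finset ι} {f g : Ω → ℝ} (hf : P.Dep S f) (hg : P.Dep S g) :
    P.Dep S (f * g) := fun ω ω' h => by
  simp only [Pi.mul_apply, hf ω ω' h, hg ω ω' h]

theorem Dep.pow {S : Finset ι} {f : Ω → ℝ} (hf : P.Dep S f) (n : ℕ) :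
    P.Dep S (f ^ n) := fun ω ω' h => by
  simp only [Pi.pow_apply, hf ω ω' h]

theorem Dep.smul {S : Finset ι} {f : Ω → ℝ} (hf : P.Dep S f) (c : ℝ) :
    P.Dep S (c • f) := fun ω ω' h => by
  simp only [Pi.smul_apply, hf ω ω' h]

theorem Dep.sum {α : Type*} {S : Finset ι} {s : Finset α} {f : α → Ω → ℝ}
    (hf : ∀ a ∈ s, P.Dep S (f a)) : P.Dep S (∑ a ∈ s, f a) := fun ω ω' h => by
  simp only [Finset.sum_apply]
  exact Finset.sum_congr rfl fun a ha => hf a ha ω ω' h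

variable [Fintype Ω] (P)

/-- The integral of a function. -/
def ex : (Ω → ℝ) →ₗ[ℝ] ℝ where
  toFun f := ∑ ω, P.prob ω * f ω
  map_add' f g := by simp [mul_add, Finset.sum_add_distrib]
  map_smul' c f := by
    simp only [Pi.smul_apply, smul_eq_mul, RingHom.id_apply, Finset.mul_sum]
    exact Finset.sum_congr rfl fun ω _ => by ring

open Classical in
/-- The points that agree with `ω` on the coordinates in `S`. -/
def fiber (S : Finset ι) (ω : Ω) : Finset Ω :=
  {ω' | ∀ i ∈ S, P.coord ω' i = P.coord ω i}

/-- Conditional expectation given the coordinates in `S`. -/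
def cex (S : Finset ι) : (Ω → ℝ) →ₗ[ℝ] (Ω → ℝ) where
  toFun f ω := (∑ ω' ∈ P.fiber S ω, P.prob ω' * f ω') / ∑ ω' ∈ P.fiber S ω, P.prob ω'
  map_add' f g := by
    ext ω; simp [mul_add, Finset.sum_add_distrib, add_div]
  map_smul' c f := by
    ext ω
    simp only [Pi.smul_apply, smul_eq_mul, RingHom.id_apply, ← mul_div_assoc, Finset.mul_sum]
    congr 1
    exact Finset.sum_congr rfl fun ω _ => by ring

/-- The `L²` norm. -/
def nrm (f : Ω → ℝ) : ℝ := √(P.ex (f ^ 2))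

theorem ex_apply (f : Ω → ℝ) : P.ex f = ∑ ω, P.prob ω * f ω := rfl

theorem cex_apply (S : Finset ι) (f : Ω → ℝ) (ω : Ω) : P.cex S f ω =
    (∑ ω' ∈ P.fiber S ω, P.prob ω' * f ω') / ∑ ω' ∈ P.fiber S ω, P.prob ω' := rfl

variable {P}

theorem mem_fiber {S : Finset ι} {ω ω' : Ω} :
    ω' ∈ P.fiber S ω ↔ ∀ i ∈ S, P.coord ω' i = P.coord ω i := by
  simp [fiber]

theorem mem_fiber_self (S : Finset ι) (ω : Ω) : ω ∈ P.fiber S ω := by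
  simp [fiber]

theorem fiber_eq {S : Finset ι} {ω ω' : Ω} (h : ∀ i ∈ S, P.coord ω' i = P.coord ω i) :
    P.fiber S ω' = P.fiber S ω := by
  ext a
  simp only [mem_fiber]
  exact forall₂_congr fun i hi => by rw [h i hi]

theorem fiber_mass_pos (S : Finset ι) (ω : Ω) : 0 < ∑ ω' ∈ P.fiber S ω, P.prob ω' :=
  Finset.sum_pos (fun ω' _ => P.prob_pos ω') ⟨ω, mem_fiber_self S ω⟩

theorem dep_cex (S : Finset ι) (f : Ω → ℝ) : P.Dep S (P.cex S f) := fun ω ω' h => by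
  simp only [cex_apply, fiber_eq h]

theorem cex_mul_of_dep {S : Finset ι} {g : Ω → ℝ} (hg : P.Dep S g) (f : Ω → ℝ) :
    P.cex S (g * f) = g * P.cex S f := by
  ext ω
  simp only [cex_apply, Pi.mul_apply, ← mul_div_assoc, Finset.mul_sum]
  congr 1
  refine Finset.sum_congr rfl fun ω' h => ?_
  rw [hg ω ω' (mem_fiber.1 h)]
  ring

theorem cex_of_dep {S : Finset ι} {g : Ω → ℝ} (hg : P.Dep S g) : P.cex S g = g := by
  have h1 : P.cex S 1 = 1 := by
    ext ω
    simp [cex_apply, (fiber_mass_pos S ω).ne']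
  have := cex_mul_of_dep hg 1
  rwa [h1, mul_one] at this

/-- Fibres partition the space and `g` is constant on each, so exchanging the two sums cancels the
fibre mass. This is self-adjointness of the projection `cex S`. -/
theorem ex_mul_cex {S : Finset ι} {g : Ω → ℝ} (hg : P.Dep S g) (f : Ω → ℝ) :
    P.ex (g * P.cex S f) = P.ex (g * f) := by
  simp only [ex_apply, Pi.mul_apply, cex_apply, ← mul_div_assoc, Finset.mul_sum,
    Finset.sum_div]
  rw [Finset.sum_comm' (t' := Finset.univ) (s' := fun ω' => P.fiber S ω')]
  · refine Finset.sum_congr rfl fun ω' _ => ?_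
    have : ∀ ω ∈ P.fiber S ω', P.prob ω * (g ω * (P.prob ω' * f ω')) /
        ∑ a ∈ P.fiber S ω, P.prob a = P.prob ω * (g ω' * (P.prob ω' * f ω') /
        ∑ a ∈ P.fiber S ω', P.prob a) := fun ω h => by
      rw [fiber_eq (mem_fiber.1 h), hg ω' ω (mem_fiber.1 h), mul_div_assoc]
    rw [Finset.sum_congr rfl this, ← Finset.sum_mul]
    have := (fiber_mass_pos (P := P) S ω').ne'
    field_simp
  · intro ω ω'
    simp only [Finset.mem_univ, true_and, and_true, mem_fiber]
    exact forall₂_congr fun i _ => eq_comm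

theorem ex_cex (S : Finset ι) (f : Ω → ℝ) : P.ex (P.cex S f) = P.ex f := by
  simpa using ex_mul_cex (P := P) (S := S) (g := 1) (fun _ _ _ => rfl) f

theorem cex_cex_of_subset {S T : Finset ι} (h : S ⊆ T) (f : Ω → ℝ) :
    P.cex T (P.cex S f) = P.cex S f := cex_of_dep ((dep_cex S f).mono h)

theorem ex_nonneg {f : Ω → ℝ} (hf : ∀ ω, 0 ≤ f ω) : 0 ≤ P.ex f :=
  Finset.sum_nonneg fun ω _ => mul_nonneg (P.prob_pos ω).le (hf ω)

theorem ex_mono {f g : Ω → ℝ} (h : ∀ ω, f ω ≤ g ω) : P.ex f ≤ P.ex g :=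
  Finset.sum_le_sum fun ω _ => mul_le_mul_of_nonneg_left (h ω) (P.prob_pos ω).le

theorem cex_mono (S : Finset ι) {f g : Ω → ℝ} (h : ∀ ω, f ω ≤ g ω) (ω : Ω) :
    P.cex S f ω ≤ P.cex S g ω :=
  div_le_div_of_nonneg_right (Finset.sum_le_sum fun ω _ =>
    mul_le_mul_of_nonneg_left (h ω) (P.prob_pos ω).le) (fiber_mass_pos S ω).le

theorem cex_nonneg (S : Finset ι) {f : Ω → ℝ} (h : ∀ ω, 0 ≤ f ω) (ω : Ω) :
    0 ≤ P.cex S f ω := by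
  simpa using cex_mono (P := P) S (f := 0) h ω

theorem cex_const (S : Finset ι) (c : ℝ) : P.cex S (fun _ => c) = fun _ => c :=
  cex_of_dep fun _ _ _ => rfl

theorem abs_cex_le (S : Finset ι) {f : Ω → ℝ} {B : ℝ} (h : ∀ ω, |f ω| ≤ B) (ω : Ω) :
    |P.cex S f ω| ≤ B := by
  rw [abs_le]
  have h1 := cex_mono (P := P) S (g := fun _ => B) (fun ω => (abs_le.1 (h ω)).2) ω
  have h2 := cex_mono (P := P) S (f := fun _ => -B) (fun ω => (abs_le.1 (h ω)).1) ω
  rw [cex_const] at h1 h2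
  exact ⟨h2, h1⟩

/-- The tower property of conditional expectations. -/
theorem cex_cex_of_superset {S T : Finset ι} (h : S ⊆ T) (f : Ω → ℝ) :
    P.cex S (P.cex T f) = P.cex S f := by
  -- The difference depends on `S` only and is orthogonal to every such function, in particular to
  -- itself.
  set d := P.cex S (P.cex T f) - P.cex S f with hd
  have hdS : P.Dep S d := fun ω ω' hω => by
    simp only [hd, Pi.sub_apply, dep_cex S _ ω ω' hω]
  have h0 : P.ex (d * d) = 0 := by
    nth_rewrite 2 [hd]
    rw [mul_sub, map_sub, ex_mul_cex hdS, ex_mul_cex hdS, ex_mul_cex (hdS.mono h), sub_self]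
  rw [ex_apply, Finset.sum_eq_zero_iff_of_nonneg fun ω _ =>
    mul_nonneg (P.prob_pos ω).le (by simpa using mul_self_nonneg (d ω))] at h0
  have : d = 0 := by
    ext ω
    have := h0 ω (Finset.mem_univ _)
    simpa [(P.prob_pos ω).ne'] using this
  exact sub_eq_zero.1 this

theorem ex_sq_nonneg (f : Ω → ℝ) : 0 ≤ P.ex (f ^ 2) := ex_nonneg fun ω => sq_nonneg (f ω)

theorem nrm_nonneg (f : Ω → ℝ) : 0 ≤ P.nrm f := Real.sqrt_nonneg _

theorem nrm_sq (f : Ω → ℝ) : P.nrm f ^ 2 = P.ex (f ^ 2) := Real.sq_sqrt (ex_sq_nonneg f)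

theorem abs_ex_mul_le (f g : Ω → ℝ) : |P.ex (f * g)| ≤ P.nrm f * P.nrm g := by
  refine abs_le_of_sq_le_sq ?_ (mul_nonneg (nrm_nonneg f) (nrm_nonneg g))
  rw [mul_pow, nrm_sq, nrm_sq]
  have h := Finset.sum_mul_sq_le_sq_mul_sq Finset.univ (fun ω => √(P.prob ω) * f ω)
    (fun ω => √(P.prob ω) * g ω)
  have h1 : ∀ ω, (√(P.prob ω)) ^ 2 = P.prob ω := fun ω => Real.sq_sqrt (P.prob_pos ω).le
  have h2 : ∀ ω, √(P.prob ω) * f ω * (√(P.prob ω) * g ω) = P.prob ω * (f ω * g ω) := fun ω => by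
    linear_combination f ω * g ω * h1 ω
  simpa only [mul_pow, h1, h2, ex_apply, Pi.mul_apply, Pi.pow_apply] using h

theorem ex_mul_le (f g : Ω → ℝ) : P.ex (f * g) ≤ P.nrm f * P.nrm g :=
  (le_abs_self _).trans (abs_ex_mul_le f g)

theorem nrm_add_le (f g : Ω → ℝ) : P.nrm (f + g) ≤ P.nrm f + P.nrm g := by
  refine abs_le_of_sq_le_sq' ?_ (add_nonneg (nrm_nonneg f) (nrm_nonneg g)) |>.2
  have : (f + g) ^ 2 = f ^ 2 + (2 : ℝ) • (f * g) + g ^ 2 := by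
    ext ω; simp; ring
  rw [nrm_sq, this, map_add, map_add, map_smul, ← nrm_sq, ← nrm_sq, smul_eq_mul]
  nlinarith [ex_mul_le (P := P) f g]

theorem nrm_smul (c : ℝ) (f : Ω → ℝ) : P.nrm (c • f) = |c| * P.nrm f := by
  rw [nrm, smul_pow, map_smul, smul_eq_mul, Real.sqrt_mul (sq_nonneg c), Real.sqrt_sq_eq_abs, nrm]

theorem nrm_sub_comm (f g : Ω → ℝ) : P.nrm (f - g) = P.nrm (g - f) := by
  rw [nrm, nrm, sub_sq_comm]

theorem nrm_sum_le {α : Type*} (s : Finset α) (f : α → Ω → ℝ) :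
    P.nrm (∑ a ∈ s, f a) ≤ ∑ a ∈ s, P.nrm (f a) :=
  Finset.le_sum_of_subadditive _ (by simp [nrm]) nrm_add_le s f

theorem nrm_mul_le {f : Ω → ℝ} {B : ℝ} (hB : ∀ ω, |f ω| ≤ B) (g : Ω → ℝ) :
    P.nrm (f * g) ≤ B * P.nrm g := by
  rcases isEmpty_or_nonempty Ω with h | ⟨⟨ω₀⟩⟩
  · simp [nrm, ex_apply]
  have hB0 : 0 ≤ B := (abs_nonneg _).trans (hB ω₀)
  refine abs_le_of_sq_le_sq' ?_ (mul_nonneg hB0 (nrm_nonneg g)) |>.2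
  rw [mul_pow, nrm_sq, nrm_sq, ← smul_eq_mul (B ^ 2), ← map_smul]
  refine ex_mono fun ω => ?_
  simp only [Pi.pow_apply, Pi.mul_apply, Pi.smul_apply, smul_eq_mul, mul_pow]
  exact mul_le_mul_of_nonneg_right (sq_le_sq' (abs_le.1 (hB ω)).1 (abs_le.1 (hB ω)).2)
    (sq_nonneg _)

theorem ex_cex_sq (S : Finset ι) (f : Ω → ℝ) :
    P.ex (P.cex S f ^ 2) = P.ex (P.cex S f * f) := by
  rw [sq, ex_mul_cex (dep_cex S f)]

theorem nrm_cex_le (S : Finset ι) (f : Ω → ℝ) : P.nrm (P.cex S f) ≤ P.nrm f := by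
  by_contra! h
  have h1 := ex_mul_le (P := P) (P.cex S f) f
  rw [← ex_cex_sq, ← nrm_sq] at h1
  nlinarith [nrm_nonneg (P := P) f]

end CoordinateSpace

/-! ### Approximate independence and the approximate Efron–Stein decomposition. -/

namespace CoordinateSpace

theorem sum_powerset_le {α : Type*} (U : Finset α) {a : Finset α → ℝ} {c : ℝ}
    (h : ∀ W ∈ U.powerset, a W ≤ c) : ∑ W ∈ U.powerset, a W ≤ 2 ^ U.card * c := by
  have := Finset.sum_le_card_nsmul _ _ _ h
  rw [Finset.card_powerset, nsmul_eq_mul] at this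
  exact_mod_cast this

theorem two_pow_card_le {α : Type*} [Fintype α] (U : Finset α) :
    (2 : ℝ) ^ U.card ≤ 2 ^ Fintype.card α :=
  pow_le_pow_right₀ one_le_two (Finset.card_le_univ U)

theorem card_family_le {α : Type*} [Fintype α] (s : Finset (Finset α)) :
    (s.card : ℝ) ≤ 2 ^ Fintype.card α := by
  have := Finset.card_le_univ s
  rw [Fintype.card_finset] at this
  exact_mod_cast this

variable {Ω ι V : Type*} [Fintype Ω] {P : CoordinateSpace Ω ι V} [DecidableEq ι]

variable (P) in
/-- The coordinates are independent up to an error `e` in operator norm. -/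
def NearProduct (e : ℝ) : Prop :=
  ∀ (S T : Finset ι) (f : Ω → ℝ), P.nrm (P.cex S (P.cex T f) - P.cex (S ∩ T) f) ≤ e * P.nrm f

variable (P) in
/-- Conditionally on any set of coordinates, any two further coordinates have maximal correlation
at most `ε`. -/
def PairwiseNearIndep (ε : ℝ) : Prop :=
  ∀ (R : Finset ι) (i j : ι), i ∉ R → j ∉ R → i ≠ j → ∀ f : Ω → ℝ,
    P.nrm (P.cex (insert i R) (P.cex (insert j R) f) - P.cex R f) ≤ ε * P.nrm f

/-- Telescoping over `S`: each new coordinate `s` costs one application of the pairwise bound,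
conditionally on `R` and the part of `S` already added. -/
theorem PairwiseNearIndep.union_insert {ε : ℝ} (hε : 0 ≤ ε) (h : P.PairwiseNearIndep ε)
    {R : Finset ι} {t : ι} (ht : t ∉ R) (f : Ω → ℝ) (S : Finset ι) (hS : Disjoint S R)
    (htS : t ∉ S) :
    P.nrm (P.cex (R ∪ S) (P.cex (insert t R) f) - P.cex R f) ≤ S.card * ε * P.nrm f := by
  induction S using Finset.induction_on with
  | empty =>
    rw [Finset.union_empty, cex_cex_of_superset (Finset.subset_insert t R), sub_self]
    simp [nrm]
  | insert s S hs ih =>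
    rw [Finset.disjoint_insert_left] at hS
    rw [Finset.mem_insert, not_or] at htS
    have h1 := h (R ∪ S) s t (by simp [hs, hS.1]) (by simp [ht, htS.2]) (Ne.symm htS.1)
      (P.cex (insert t R) f)
    rw [cex_cex_of_subset (Finset.insert_subset_insert t Finset.subset_union_left)] at h1
    have h2 := ih hS.2 htS.2
    have h3 := nrm_add_le (P := P)
      (P.cex (insert s (R ∪ S)) (P.cex (insert t R) f) - P.cex (R ∪ S) (P.cex (insert t R) f))
      (P.cex (R ∪ S) (P.cex (insert t R) f) - P.cex R f)
    rw [sub_add_sub_cancel] at h3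
    rw [Finset.union_insert, Finset.card_insert_of_notMem hs]
    have h4 := mul_le_mul_of_nonneg_left (nrm_cex_le (P := P) (insert t R) f) hε
    push_cast
    linarith

/-- Telescoping over `T`: each new `t` costs `|S| ε` by the previous bound, conditionally on `R ∪
T`, and projecting back to `R ∪ S` does not increase norms. -/
theorem PairwiseNearIndep.union_union {ε : ℝ} (hε : 0 ≤ ε) (h : P.PairwiseNearIndep ε)
    {R S : Finset ι} (hS : Disjoint S R) (f : Ω → ℝ) (T : Finset ι) (hT : Disjoint T R)
    (hTS : Disjoint T S) :
    P.nrm (P.cex (R ∪ S) (P.cex (R ∪ T) f) - P.cex R f) ≤ S.card * T.card * ε * P.nrm f := by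
  induction T using Finset.induction_on with
  | empty =>
    rw [Finset.union_empty, cex_cex_of_subset Finset.subset_union_left, sub_self]
    simp [nrm]
  | insert t T ht ih =>
    rw [Finset.disjoint_insert_left] at hT hTS
    have h1 := h.union_insert hε (R := R ∪ T) (t := t) (by simp [ht, hT.1]) f S
      (by rw [Finset.disjoint_union_right]; exact ⟨hS, hTS.2.symm⟩) hTS.1
    have h2 := (nrm_cex_le (P := P) (R ∪ S) _).trans h1
    rw [map_sub, cex_cex_of_superset (Finset.union_subset_union_left Finset.subset_union_left)]
      at h2
    have h3 := nrm_add_le (P := P)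
      (P.cex (R ∪ S) (P.cex (insert t (R ∪ T)) f) - P.cex (R ∪ S) (P.cex (R ∪ T) f))
      (P.cex (R ∪ S) (P.cex (R ∪ T) f) - P.cex R f)
    rw [sub_add_sub_cancel] at h3
    rw [Finset.union_insert, Finset.card_insert_of_notMem ht]
    have h4 := ih hT.2 hTS.2
    push_cast
    linarith

/-- Condition on `S ∩ T` and separate `S \ T` from `T \ S`: at most `|ι|²` pairs of coordinates are
decoupled. -/
theorem PairwiseNearIndep.nearProduct [Fintype ι] {ε : ℝ} (hε : 0 ≤ ε)
    (h : P.PairwiseNearIndep ε) : P.NearProduct ((Fintype.card ι : ℝ) ^ 2 * ε) := by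
  intro S T f
  have h1 := h.union_union hε (R := S ∩ T) (S := S \ T)
    (Finset.disjoint_sdiff_inter S T) f (T \ S)
    (by rw [Finset.inter_comm]; exact Finset.disjoint_sdiff_inter T S)
    (disjoint_sdiff_sdiff)
  rw [Finset.union_comm, Finset.sdiff_union_inter, Finset.union_comm,
    show T \ S ∪ S ∩ T = T by rw [Finset.inter_comm, Finset.sdiff_union_inter]] at h1
  refine h1.trans (mul_le_mul_of_nonneg_right (mul_le_mul_of_nonneg_right ?_ hε) (nrm_nonneg f))
  rw [sq]
  exact mul_le_mul (by exact_mod_cast Finset.card_le_univ _)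
    (by exact_mod_cast Finset.card_le_univ _) (Nat.cast_nonneg _) (Nat.cast_nonneg _)

variable (P) in
/-- The component of `f` at `U` in the Efron–Stein decomposition relative to the coordinates
in `Q`. -/
def es (Q U : Finset ι) : (Ω → ℝ) →ₗ[ℝ] (Ω → ℝ) :=
  ∑ W ∈ U.powerset, (-1 : ℝ) ^ (U \ W).card • P.cex (Q ∪ W)

theorem es_apply (Q U : Finset ι) (f : Ω → ℝ) :
    P.es Q U f = ∑ W ∈ U.powerset, (-1 : ℝ) ^ (U \ W).card • P.cex (Q ∪ W) f := by
  simp [es]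

theorem es_empty (Q : Finset ι) : P.es Q ∅ = P.cex Q := by
  simp [es]

/-- A component is an iterated difference: adding `i` to `U` takes the difference between knowing
and not knowing coordinate `i`. -/
theorem es_insert (Q : Finset ι) {U : Finset ι} {i : ι} (hi : i ∉ U) :
    P.es Q (insert i U) = P.es (insert i Q) U - P.es Q U := by
  rw [es, Finset.sum_powerset_insert hi, add_comm, sub_eq_add_neg, es, es, ← Finset.sum_neg_distrib]
  congr 1 <;> refine Finset.sum_congr rfl fun W hW => ?_
  · rw [Finset.mem_powerset] at hW
    rw [Finset.insert_sdiff_insert, Finset.sdiff_insert_of_notMem hi, Finset.union_insert,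
      Finset.insert_union]
  · rw [Finset.mem_powerset] at hW
    rw [Finset.insert_sdiff_of_notMem _ fun h => hi (hW h),
      Finset.card_insert_of_notMem (by simp [hi]), pow_succ, mul_neg_one]
    ext f ω; simp

theorem sum_es (Q W : Finset ι) : ∑ U ∈ W.powerset, P.es Q U = P.cex (Q ∪ W) := by
  induction W using Finset.induction_on generalizing Q with
  | empty => simp [es_empty]
  | insert i W hi ih =>
    rw [Finset.sum_powerset_insert hi, ← Finset.sum_add_distrib]
    have : ∀ U ∈ W.powerset, P.es Q U + P.es Q (insert i U) = P.es (insert i Q) U :=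
      fun U hU => by
        rw [es_insert Q fun h => hi (Finset.mem_powerset.1 hU h), add_sub_cancel]
    rw [Finset.sum_congr rfl this, ih, Finset.union_insert, Finset.insert_union]

theorem dep_es (Q U : Finset ι) (f : Ω → ℝ) : P.Dep (Q ∪ U) (P.es Q U f) := by
  rw [es_apply]
  exact Dep.sum fun W hW => ((dep_cex _ f).mono
    (Finset.union_subset_union_right (Finset.mem_powerset.1 hW))).smul _

/-- Choose `i ∈ U \ W`. The terms of the alternating sum with and without `i` have the same
intersection with `W`, so after `cex W` they cancel up to `2e`; there are `2 ^ (|U| - 1)` such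
pairs. -/
theorem nrm_cex_es_le {e : ℝ} (h : P.NearProduct e) (Q : Finset ι) {U W : Finset ι}
    (hUW : ¬ U ⊆ W) (f : Ω → ℝ) : P.nrm (P.cex W (P.es Q U f)) ≤ 2 ^ U.card * (e * P.nrm f) := by
  obtain ⟨i, hiU, hiW⟩ := Finset.not_subset.1 hUW
  rw [← Finset.insert_erase hiU, es_insert Q (Finset.notMem_erase i U),
    Finset.card_insert_of_notMem (Finset.notMem_erase i U), LinearMap.sub_apply, es_apply, es_apply,
    ← Finset.sum_sub_distrib, map_sum]
  refine (nrm_sum_le _ _).trans ?_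
  rw [pow_succ, mul_assoc]
  refine sum_powerset_le _ fun T _ => ?_
  rw [← smul_sub, map_smul, nrm_smul, abs_pow, abs_neg, abs_one, one_pow, one_mul, map_sub]
  have h1 := h W (insert i Q ∪ T) f
  have h2 := h W (Q ∪ T) f
  rw [Finset.insert_union, Finset.inter_insert_of_notMem hiW] at h1
  rw [nrm_sub_comm] at h2
  have h3 := nrm_add_le (P := P) (P.cex W (P.cex (insert i (Q ∪ T)) f) - P.cex (W ∩ (Q ∪ T)) f)
    (P.cex (W ∩ (Q ∪ T)) f - P.cex W (P.cex (Q ∪ T) f))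
  rw [sub_add_sub_cancel] at h3
  rw [Finset.insert_union]
  linarith

theorem nrm_es_le (Q U : Finset ι) (f : Ω → ℝ) : P.nrm (P.es Q U f) ≤ 2 ^ U.card * P.nrm f := by
  rw [es_apply]
  refine (nrm_sum_le _ _).trans ?_
  refine sum_powerset_le _ fun T _ => ?_
  rw [nrm_smul, abs_pow, abs_neg, abs_one, one_pow, one_mul]
  exact nrm_cex_le _ f

theorem abs_es_le (Q U : Finset ι) {f : Ω → ℝ} (hf : ∀ ω, |f ω| ≤ 1) (ω : Ω) :
    |P.es Q U f ω| ≤ 2 ^ U.card := by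
  rw [es_apply, Finset.sum_apply]
  refine (Finset.abs_sum_le_sum_abs _ _).trans ?_
  rw [← mul_one (2 ^ U.card : ℝ)]
  refine sum_powerset_le _ fun T _ => ?_
  rw [Pi.smul_apply, smul_eq_mul, abs_mul, abs_pow, abs_neg, abs_one, one_pow, one_mul]
  exact abs_cex_le _ hf ω

variable [Fintype ι]

/-- Near-orthogonality of distinct components, even against a bounded weight on the coordinates `Q`:
one of `U`, `U'` is not contained in the other, so its component almost vanishes when projected to
the coordinates of the remaining factors. -/
theorem abs_ex_mul_es_mul_es_le {e B : ℝ} (he : 0 ≤ e) (h : P.NearProduct e) {Q U U' : Finset ι}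
    (hU : Disjoint U Q) (hU' : Disjoint U' Q) (hUU : U ≠ U') {s : Ω → ℝ} (hs : P.Dep Q s)
    (hB : ∀ ω, |s ω| ≤ B) (f : Ω → ℝ) : |P.ex (s * P.es Q U f * P.es Q U' f)| ≤
      B * (2 ^ Fintype.card ι) ^ 2 * e * P.nrm f ^ 2 := by
  rcases isEmpty_or_nonempty Ω with hΩ | ⟨⟨ω₀⟩⟩
  · simp [nrm, ex_apply]
  have hB0 : 0 ≤ B := (abs_nonneg _).trans (hB ω₀)
  wlog hsub : ¬ U' ⊆ U generalizing U U'
  · rw [mul_right_comm]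
    exact this hU' hU hUU.symm fun h' => hUU (h'.antisymm (not_not.1 hsub))
  have hdep : P.Dep (Q ∪ U) (s * P.es Q U f) :=
    (hs.mono Finset.subset_union_left).mul (dep_es Q U f)
  rw [← ex_mul_cex hdep]
  refine (abs_ex_mul_le _ _).trans ?_
  have h1 : ¬ U' ⊆ Q ∪ U := fun h' => hsub fun i hi =>
    (Finset.mem_union.1 (h' hi)).resolve_left (Finset.disjoint_left.1 hU' hi)
  have h2 := nrm_cex_es_le h Q h1 f
  have h3 := (nrm_mul_le hB (P.es Q U f)).trans
    (mul_le_mul_of_nonneg_left (nrm_es_le Q U f) hB0)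
  have hn := nrm_nonneg (P := P) f
  calc _ ≤ (B * (2 ^ Fintype.card ι * P.nrm f)) * (2 ^ Fintype.card ι * (e * P.nrm f)) := by
        refine mul_le_mul (h3.trans ?_) (h2.trans ?_) (nrm_nonneg _) (by positivity)
        · gcongr; · exact one_le_two
          exact Finset.card_le_univ U
        · gcongr; · exact one_le_two
          exact Finset.card_le_univ U'
    _ = _ := by ring

/-- Approximate Pythagorean theorem for the Efron–Stein components. -/
theorem abs_ex_mul_sum_es_sq_sub_le {e B : ℝ} (he : 0 ≤ e) (hB0 : 0 ≤ B) (h : P.NearProduct e)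
    {Q : Finset ι} {𝒰 : Finset (Finset ι)} (hU : ∀ U ∈ 𝒰, Disjoint U Q) {s : Ω → ℝ}
    (hs : P.Dep Q s) (hB : ∀ ω, |s ω| ≤ B) (f : Ω → ℝ) :
    |P.ex (s * (∑ U ∈ 𝒰, P.es Q U f) ^ 2) - ∑ U ∈ 𝒰, P.ex (s * P.es Q U f ^ 2)| ≤
      B * (2 ^ Fintype.card ι) ^ 4 * e * P.nrm f ^ 2 := by
  set E := B * (2 ^ Fintype.card ι) ^ 2 * e * P.nrm f ^ 2 with hE
  have hE0 : 0 ≤ E := by have := nrm_nonneg (P := P) f; positivity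
  have h1 : P.ex (s * (∑ U ∈ 𝒰, P.es Q U f) ^ 2) =
      ∑ U ∈ 𝒰, ∑ U' ∈ 𝒰, P.ex (s * P.es Q U f * P.es Q U' f) := by
    rw [sq, Finset.sum_mul_sum, Finset.mul_sum, map_sum]
    refine Finset.sum_congr rfl fun U _ => ?_
    rw [Finset.mul_sum, map_sum]
    simp only [mul_assoc]
  have h2 : ∑ U ∈ 𝒰, P.ex (s * P.es Q U f ^ 2) =
      ∑ U ∈ 𝒰, ∑ U' ∈ 𝒰, if U = U' then P.ex (s * P.es Q U f * P.es Q U' f) else 0 := by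
    refine Finset.sum_congr rfl fun U hU => ?_
    rw [Finset.sum_ite_eq, if_pos hU, sq, mul_assoc]
  rw [h1, h2, ← Finset.sum_sub_distrib]
  have h3 : ∀ U ∈ 𝒰, |∑ U' ∈ 𝒰, P.ex (s * P.es Q U f * P.es Q U' f) -
      ∑ U' ∈ 𝒰, if U = U' then P.ex (s * P.es Q U f * P.es Q U' f) else 0| ≤ 𝒰.card • E := by
    intro U hU1
    rw [← Finset.sum_sub_distrib]
    refine (Finset.abs_sum_le_sum_abs _ _).trans (Finset.sum_le_card_nsmul _ _ _ fun U' hU2 => ?_)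
    split_ifs with hUU
    · simpa using hE0
    · rw [sub_zero]
      exact abs_ex_mul_es_mul_es_le he h (hU U hU1) (hU U' hU2) hUU hs hB f
  refine (Finset.abs_sum_le_sum_abs _ _).trans ((Finset.sum_le_card_nsmul _ _ _ h3).trans ?_)
  rw [nsmul_eq_mul, nsmul_eq_mul]
  have h4 := card_family_le 𝒰
  calc (𝒰.card : ℝ) * (𝒰.card * E) ≤ 2 ^ Fintype.card ι * (2 ^ Fintype.card ι * E) := by gcongr
    _ = _ := by rw [hE]; ring

/-- The other two factors depend only on `A ∪ T`, and the component at `S` almost vanishes when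
projected there. -/
theorem abs_ex_cex_mul_es_mul_es_le {e : ℝ} (he : 0 ≤ e) (h : P.NearProduct e)
    {A S T : Finset ι} (hS : ¬ S ⊆ A ∪ T) {f : Ω → ℝ} (hf : ∀ ω, |f ω| ≤ 1) :
    |P.ex (P.cex A f * (P.es ∅ S f * P.es ∅ T f))| ≤
      (2 ^ Fintype.card ι) ^ 2 * e * P.nrm f ^ 2 := by
  have hT : P.Dep T (P.es ∅ T f) := by simpa using dep_es ∅ T f
  have hdep : P.Dep (A ∪ T) (P.cex A f * P.es ∅ T f) :=
    ((dep_cex A f).mono Finset.subset_union_left).mul (hT.mono Finset.subset_union_right)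
  rw [mul_comm (P.es ∅ S f), ← mul_assoc, ← ex_mul_cex hdep]
  refine (abs_ex_mul_le _ _).trans ?_
  have h1 := nrm_mul_le (P := P) (f := P.cex A f) (abs_cex_le A hf) (P.es ∅ T f)
  have h2 := nrm_es_le (P := P) ∅ T f
  have h3 := nrm_cex_es_le h ∅ hS f
  have hn := nrm_nonneg (P := P) f
  calc _ ≤ (2 ^ Fintype.card ι * P.nrm f) * (2 ^ Fintype.card ι * (e * P.nrm f)) := by
        refine mul_le_mul ?_ (h3.trans ?_) (nrm_nonneg _) (by positivity)
        · rw [one_mul] at h1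
          refine h1.trans (h2.trans ?_)
          gcongr; · exact one_le_two
          exact Finset.card_le_univ T
        · gcongr; · exact one_le_two
          exact Finset.card_le_univ S
    _ = _ := by ring

/-- In the triple product, `f` may be replaced by its component at the symmetric difference,
relative to the intersection. -/
theorem ex_mul_es_mul_es_le {e : ℝ} (he : 0 ≤ e) (h : P.NearProduct e)
    (S T : Finset ι) {f : Ω → ℝ} (hf : ∀ ω, |f ω| ≤ 1) :
    P.ex (f * (P.es ∅ S f * P.es ∅ T f)) ≤
      P.ex (P.es (S ∩ T) (S \ T ∪ T \ S) f * (P.es ∅ S f * P.es ∅ T f)) +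
      (2 ^ Fintype.card ι) ^ 3 * e * P.nrm f ^ 2 := by
  set U := S \ T ∪ T \ S with hU
  set F := P.es ∅ S f * P.es ∅ T f with hF
  have hn := nrm_nonneg (P := P) f
  have hQU : S ∩ T ∪ U = S ∪ T := by
    ext i; simp only [hU, Finset.mem_union, Finset.mem_inter, Finset.mem_sdiff]; tauto
  have hdF : P.Dep (S ∪ T) F := by
    have h1 := dep_es (P := P) ∅ S f
    have h2 := dep_es (P := P) ∅ T f
    rw [Finset.empty_union] at h1 h2
    exact (h1.mono Finset.subset_union_left).mul (h2.mono Finset.subset_union_right)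
  have h1 : P.ex (P.es (S ∩ T) U f * F) =
      ∑ W ∈ U.powerset, (-1 : ℝ) ^ (U \ W).card * P.ex (P.cex (S ∩ T ∪ W) f * F) := by
    rw [es_apply, Finset.sum_mul, map_sum]
    simp only [smul_mul_assoc, map_smul, smul_eq_mul]
  -- The term `W = U` conditions on `S ∪ T`, where `F` lives, so it equals the original triple
  -- product. Every other `W` misses a point of `S \ T` or `T \ S`, and its term is small.
  rw [← Finset.add_sum_erase _ _ (Finset.mem_powerset_self U), hQU, Finset.sdiff_self,
    Finset.card_empty, pow_zero, one_mul, mul_comm (P.cex (S ∪ T) f), ex_mul_cex hdF, mul_comm F f] at h1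
  have h2 : |∑ W ∈ U.powerset.erase U, (-1 : ℝ) ^ (U \ W).card * P.ex (P.cex (S ∩ T ∪ W) f * F)| ≤
      (U.powerset.erase U).card • ((2 ^ Fintype.card ι) ^ 2 * e * P.nrm f ^ 2) := by
    refine (Finset.abs_sum_le_sum_abs _ _).trans (Finset.sum_le_card_nsmul _ _ _ fun W hW => ?_)
    rw [abs_mul, abs_pow, abs_neg, abs_one, one_pow, one_mul]
    rw [Finset.mem_erase, Finset.mem_powerset] at hW
    obtain ⟨i, hiU, hiW⟩ := Finset.not_subset.1 fun h' => hW.1 (hW.2.antisymm h')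
    rw [hU, Finset.mem_union, Finset.mem_sdiff, Finset.mem_sdiff] at hiU
    rcases hiU with hi | hi
    · refine abs_ex_cex_mul_es_mul_es_le he h (fun h' => ?_) hf
      have := h' hi.1
      simp [hi.1, hi.2, hiW] at this
    · rw [hF, mul_comm (P.es ∅ S f)]
      refine abs_ex_cex_mul_es_mul_es_le he h (fun h' => ?_) hf
      have := h' hi.1
      simp [hi.1, hi.2, hiW] at this
  rw [nsmul_eq_mul] at h2
  have h3 : ((U.powerset.erase U).card : ℝ) * ((2 ^ Fintype.card ι) ^ 2 * e * P.nrm f ^ 2) ≤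
      2 ^ Fintype.card ι * ((2 ^ Fintype.card ι) ^ 2 * e * P.nrm f ^ 2) := by
    gcongr; exact card_family_le _
  have h4 := (abs_le.1 h2).1
  rw [h1]
  linarith

end CoordinateSpace

/-! ### The triple product of a global function with its low-degree part. -/

namespace CoordinateSpace

variable {Ω ι V : Type*} [Fintype Ω] {P : CoordinateSpace Ω ι V} [DecidableEq ι] [Fintype ι]

theorem abs_es_le_two_pow_card (Q U : Finset ι) {f : Ω → ℝ} (hf : ∀ ω, |f ω| ≤ 1) (ω : Ω) :
    |P.es Q U f ω| ≤ 2 ^ Fintype.card ι :=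
  (abs_es_le Q U hf ω).trans (two_pow_card_le U)

theorem nrm_es_le_two_pow_card (Q U : Finset ι) (f : Ω → ℝ) :
    P.nrm (P.es Q U f) ≤ 2 ^ Fintype.card ι * P.nrm f :=
  (nrm_es_le Q U f).trans (mul_le_mul_of_nonneg_right (two_pow_card_le U) (nrm_nonneg f))

/-- Conditionally on the common coordinates, the squares of two components are almost
uncorrelated. -/
theorem ex_mul_sq_mul_sq_le {e B : ℝ} (he : 0 ≤ e) (hB0 : 0 ≤ B) (h : P.NearProduct e)
    (S T : Finset ι) {f t : Ω → ℝ} (hf : ∀ ω, |f ω| ≤ 1) (ht : P.Dep (S ∩ T) t)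
    (hB : ∀ ω, |t ω| ≤ B) :
    P.ex (t * (P.es ∅ S f ^ 2 * P.es ∅ T f ^ 2)) ≤
      P.ex (t * (P.cex (S ∩ T) (P.es ∅ S f ^ 2) * P.cex (S ∩ T) (P.es ∅ T f ^ 2))) +
      B * (2 ^ Fintype.card ι) ^ 4 * e * P.nrm f ^ 2 := by
  set a := P.es ∅ S f with ha
  set b := P.es ∅ T f with hb
  have hn := nrm_nonneg (P := P) f
  have haS : P.Dep S a := by simpa using dep_es ∅ S f
  have hbT : P.Dep T b := by simpa using dep_es ∅ T f
  have hd : P.Dep S (t * a ^ 2) := (ht.mono Finset.inter_subset_left).mul (haS.pow 2)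
  -- Since `b ^ 2` is its own expectation given `T`, near-independence replaces `cex S (cex T (b ^
  -- 2))` by `cex (S ∩ T) (b ^ 2)`.
  have h1 : P.ex (t * (a ^ 2 * b ^ 2)) = P.ex (t * a ^ 2 * P.cex S (P.cex T (b ^ 2))) := by
    rw [ex_mul_cex hd, cex_of_dep (hbT.pow 2), mul_assoc]
  have h2 : P.ex (t * (P.cex (S ∩ T) (a ^ 2) * P.cex (S ∩ T) (b ^ 2))) =
      P.ex (t * a ^ 2 * P.cex (S ∩ T) (b ^ 2)) := by
    rw [mul_comm (P.cex (S ∩ T) (a ^ 2)), ← mul_assoc, ex_mul_cex (ht.mul (dep_cex _ _))]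
    congr 1; ring
  have h3 := ex_mul_le (P := P) (t * a ^ 2) (P.cex S (P.cex T (b ^ 2)) - P.cex (S ∩ T) (b ^ 2))
  rw [mul_sub, map_sub] at h3
  have h4 : P.nrm (t * a ^ 2) ≤ B * (2 ^ Fintype.card ι * (2 ^ Fintype.card ι * P.nrm f)) := by
    refine (nrm_mul_le hB _).trans (mul_le_mul_of_nonneg_left ?_ hB0)
    rw [sq]
    refine (nrm_mul_le (f := a) (abs_es_le_two_pow_card ∅ S hf) _).trans ?_
    gcongr
    exact nrm_es_le_two_pow_card ∅ S f
  have h5 : P.nrm (P.cex S (P.cex T (b ^ 2)) - P.cex (S ∩ T) (b ^ 2)) ≤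
      e * (2 ^ Fintype.card ι * (2 ^ Fintype.card ι * P.nrm f)) := by
    refine (h S T _).trans (mul_le_mul_of_nonneg_left ?_ he)
    rw [sq]
    refine (nrm_mul_le (f := b) (abs_es_le_two_pow_card ∅ T hf) _).trans ?_
    gcongr
    exact nrm_es_le_two_pow_card ∅ T f
  have h6 := mul_le_mul h4 h5 (nrm_nonneg _) (by positivity)
  rw [h1, h2]
  calc _ ≤ P.ex (t * a ^ 2 * P.cex (S ∩ T) (b ^ 2)) +
        B * (2 ^ Fintype.card ι * (2 ^ Fintype.card ι * P.nrm f)) *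
        (e * (2 ^ Fintype.card ι * (2 ^ Fintype.card ι * P.nrm f))) := by linarith
    _ = _ := by ring

variable (ι) in
/-- The sets of at most `d` coordinates. -/
def lowSets (d : ℕ) : Finset (Finset ι) := {S | S.card ≤ d}

/-- The pairs of sets of at most `d` coordinates with intersection `Q`. -/
def lowPairs (d : ℕ) (Q : Finset ι) : Finset (Finset ι × Finset ι) :=
  {x ∈ lowSets ι d ×ˢ lowSets ι d | x.1 ∩ x.2 = Q}

theorem mem_lowSets {α : Type*} [Fintype α] {d : ℕ} {S : Finset α} :
    S ∈ lowSets α d ↔ S.card ≤ d := by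
  simp [lowSets]

theorem mem_lowPairs {d : ℕ} {Q : Finset ι} {x : Finset ι × Finset ι} :
    x ∈ lowPairs d Q ↔ (x.1.card ≤ d ∧ x.2.card ≤ d) ∧ x.1 ∩ x.2 = Q := by
  simp [lowPairs, mem_lowSets]

theorem card_lowPairs_le (d : ℕ) (Q : Finset ι) :
    ((lowPairs d Q).card : ℝ) ≤ (2 ^ Fintype.card ι) ^ 2 := by
  have := Finset.card_le_univ (lowPairs d Q)
  rw [Fintype.card_prod, Fintype.card_finset, ← sq] at this
  exact_mod_cast this

/-- For fixed intersection `Q` and symmetric difference `U`, a pair is determined by `S \ T ⊆ U`. As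
`|U| ≤ 2d`, at most `4 ^ d` pairs share the same `U`. -/
theorem sum_lowPairs_symmDiff_le (d : ℕ) (Q : Finset ι) {a : Finset ι → ℝ} (ha : ∀ U, 0 ≤ a U) :
    ∑ x ∈ lowPairs d Q, a (x.1 \ x.2 ∪ x.2 \ x.1) ≤ 4 ^ d * ∑ U ∈ Qᶜ.powerset, a U := by
  have hmaps : ∀ x ∈ lowPairs d Q, x.1 \ x.2 ∪ x.2 \ x.1 ∈ Qᶜ.powerset := fun x hx => by
    rw [Finset.mem_powerset]
    intro i hi
    rw [Finset.mem_compl, ← (mem_lowPairs.1 hx).2]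
    simp only [Finset.mem_union, Finset.mem_sdiff, Finset.mem_inter] at hi ⊢
    tauto
  rw [← Finset.sum_fiberwise_of_maps_to hmaps, Finset.mul_sum]
  refine Finset.sum_le_sum fun U _ => ?_
  have h1 : ∀ x ∈ (lowPairs d Q).filter (fun x => x.1 \ x.2 ∪ x.2 \ x.1 = U),
      a (x.1 \ x.2 ∪ x.2 \ x.1) = a U := fun x hx => by rw [(Finset.mem_filter.1 hx).2]
  rw [Finset.sum_congr rfl h1, Finset.sum_const, nsmul_eq_mul]
  refine mul_le_mul_of_nonneg_right ?_ (ha U)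
  rcases Finset.eq_empty_or_nonempty ((lowPairs d Q).filter
    (fun x => x.1 \ x.2 ∪ x.2 \ x.1 = U)) with h2 | ⟨x, hx⟩
  · rw [h2]; simp
  have hU : U.card ≤ 2 * d := by
    rw [Finset.mem_filter, mem_lowPairs] at hx
    rw [← hx.2]
    have h3 := Finset.card_union_le (x.1 \ x.2) (x.2 \ x.1)
    have h4 := Finset.card_le_card (Finset.sdiff_subset (s := x.1) (t := x.2))
    have h5 := Finset.card_le_card (Finset.sdiff_subset (s := x.2) (t := x.1))
    omega
  have h3 : ((lowPairs d Q).filter (fun x => x.1 \ x.2 ∪ x.2 \ x.1 = U)).card ≤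
      U.powerset.card := by
    refine Finset.card_le_card_of_injOn (fun x => x.1 \ x.2) ?_ ?_
    · intro x hx
      rw [Finset.mem_coe, Finset.mem_filter] at hx
      rw [Finset.mem_coe, Finset.mem_powerset, ← hx.2]
      exact Finset.subset_union_left
    · intro x hx y hy hxy
      rw [Finset.mem_coe, Finset.mem_filter, mem_lowPairs] at hx hy
      simp only at hxy
      have e1 : x.1 = y.1 := by
        rw [← Finset.sdiff_union_inter x.1 x.2, ← Finset.sdiff_union_inter y.1 y.2, hx.1.2,
          hy.1.2, hxy]
      have e2 : x.2 \ x.1 = y.2 \ y.1 := by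
        have h4 : ∀ z : Finset ι × Finset ι, z.2 \ z.1 = (z.1 \ z.2 ∪ z.2 \ z.1) \ (z.1 \ z.2) :=
          fun z => by
            rw [Finset.union_sdiff_cancel_left disjoint_sdiff_sdiff]
        rw [h4 x, h4 y, hx.2, hy.2, hxy]
      refine Prod.ext e1 ?_
      rw [← Finset.sdiff_union_inter x.2 x.1, ← Finset.sdiff_union_inter y.2 y.1, e2,
        Finset.inter_comm, hx.1.2, Finset.inter_comm, hy.1.2]
  rw [Finset.card_powerset] at h3
  calc _ ≤ ((2 ^ U.card : ℕ) : ℝ) := by exact_mod_cast h3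
    _ ≤ ((2 ^ (2 * d) : ℕ) : ℝ) := by exact_mod_cast Nat.pow_le_pow_right (by norm_num) hU
    _ = 4 ^ d := by rw [pow_mul]; norm_num

variable (P) in
/-- The influence of the coordinates in `Q` on the part of `f` of degree at most `d`. -/
def influence (d : ℕ) (f : Ω → ℝ) (Q : Finset ι) : Ω → ℝ :=
  ∑ S ∈ lowSets ι d with Q ⊆ S, P.cex Q (P.es ∅ S f ^ 2)

theorem dep_influence (d : ℕ) (f : Ω → ℝ) (Q : Finset ι) : P.Dep Q (P.influence d f Q) :=
  Dep.sum fun _ _ => dep_cex _ _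

theorem influence_nonneg (d : ℕ) (f : Ω → ℝ) (Q : Finset ι) (ω : Ω) :
    0 ≤ P.influence d f Q ω := by
  rw [influence, Finset.sum_apply]
  exact Finset.sum_nonneg fun S _ => cex_nonneg Q (fun ω => sq_nonneg (P.es ∅ S f ω)) ω

theorem influence_le (d : ℕ) {f : Ω → ℝ} (hf : ∀ ω, |f ω| ≤ 1) (Q : Finset ι) (ω : Ω) :
    P.influence d f Q ω ≤ (2 ^ Fintype.card ι) ^ 3 := by
  rw [influence, Finset.sum_apply]
  have h1 : ∀ S ∈ (lowSets ι d).filter (Q ⊆ ·),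
      P.cex Q (P.es ∅ S f ^ 2) ω ≤ (2 ^ Fintype.card ι) ^ 2 := fun S _ => by
    refine (le_abs_self _).trans (abs_cex_le Q (fun ω => ?_) ω)
    rw [Pi.pow_apply, abs_pow]
    exact pow_le_pow_left₀ (abs_nonneg _) (abs_es_le_two_pow_card ∅ S hf ω) 2
  refine (Finset.sum_le_card_nsmul _ _ _ h1).trans ?_
  rw [nsmul_eq_mul, pow_succ' _ 2]
  gcongr
  exact card_family_le _

/-- Each `S` is counted once for every `Q ⊆ S`, hence at most `2 ^ d` times. -/
theorem sum_ex_influence_le (d : ℕ) (f : Ω → ℝ) :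
    ∑ Q ∈ lowSets ι d, P.ex (P.influence d f Q) ≤
      2 ^ d * ∑ S ∈ lowSets ι d, P.ex (P.es ∅ S f ^ 2) := by
  simp only [influence, map_sum, ex_cex]
  rw [Finset.sum_comm' (t' := lowSets ι d) (s' := fun S => (lowSets ι d).filter (· ⊆ S))]
  · rw [Finset.mul_sum]
    refine Finset.sum_le_sum fun S hS => ?_
    rw [Finset.sum_const, nsmul_eq_mul]
    refine mul_le_mul_of_nonneg_right ?_ (ex_sq_nonneg _)
    have h1 : (lowSets ι d).filter (· ⊆ S) ⊆ S.powerset := fun Q hQ => by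
      rw [Finset.mem_powerset]; exact (Finset.mem_filter.1 hQ).2
    have h2 := Finset.card_le_card h1
    rw [Finset.card_powerset] at h2
    have h3 := h2.trans (Nat.pow_le_pow_right (by norm_num) (mem_lowSets.1 hS))
    exact_mod_cast h3
  · intro Q S
    simp only [Finset.mem_filter]
    tauto

theorem sum_lowPairs_mul_le_influence_sq (d : ℕ) (f : Ω → ℝ) (Q : Finset ι) (ω : Ω) :
    ∑ x ∈ lowPairs d Q, P.cex Q (P.es ∅ x.1 f ^ 2) ω * P.cex Q (P.es ∅ x.2 f ^ 2) ω ≤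
      P.influence d f Q ω ^ 2 := by
  have h0 : ∀ S, 0 ≤ P.cex Q (P.es ∅ S f ^ 2) ω := fun S =>
    cex_nonneg Q (fun ω => sq_nonneg (P.es ∅ S f ω)) ω
  rw [influence, Finset.sum_apply, sq, Finset.sum_mul_sum, ← Finset.sum_product']
  refine Finset.sum_le_sum_of_subset_of_nonneg (fun x hx => ?_)
    fun x _ _ => mul_nonneg (h0 x.1) (h0 x.2)
  rw [mem_lowPairs] at hx
  simp only [Finset.mem_product, Finset.mem_filter, mem_lowSets]
  exact ⟨⟨hx.1.1, hx.2 ▸ Finset.inter_subset_left⟩, hx.1.2, hx.2 ▸ Finset.inter_subset_right⟩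

/-- Apply `hF ≤ (s h² + t F²) / 2` with `s t = 1` to each pair, where `h` is the component of `f`
and `F` the product of the two low-degree components. The first sum is controlled by globalness, the
second by the influence. -/
theorem ex_triple_le_of_inter_eq {e δ η : ℝ} (he : 0 ≤ e) (hδ : 0 < δ) (hδ1 : δ ≤ 1)
    (hη : 0 < η) (hη1 : η ≤ 1)
    (h : P.NearProduct e) {d : ℕ} (hd : d ≤ Fintype.card ι) {f : Ω → ℝ}
    (hf : ∀ ω, f ω = 0 ∨ f ω = 1) (hfdep : P.Dep Finset.univ f) {Q : Finset ι}
    (hglob : ∀ ω, P.cex Q f ω ≤ δ ^ 2) :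
    ∑ x ∈ lowPairs d Q, P.ex (P.es Q (x.1 \ x.2 ∪ x.2 \ x.1) f * (P.es ∅ x.1 f * P.es ∅ x.2 f)) ≤
      2 ^ d * δ * P.ex (P.influence d f Q) + P.nrm f ^ 2 *
      (2 ^ Fintype.card ι * (η / δ) + (2 ^ Fintype.card ι) ^ 9 * (e / δ) +
        (2 ^ Fintype.card ι) ^ 7 * (e / η)) := by
  have hf1 : ∀ ω, |f ω| ≤ 1 := fun ω => by rcases hf ω with h | h <;> simp [h]
  have hff : f ^ 2 = f := by ext ω; rcases hf ω with h | h <;> simp [h]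
  have hμ : P.nrm f ^ 2 = P.ex f := by rw [nrm_sq, hff]
  set M : ℝ := 2 ^ Fintype.card ι with hM
  set I := P.influence d f Q with hI
  set μ := P.nrm f ^ 2 with hμ'
  have hμ0 : 0 ≤ μ := sq_nonneg _
  have hM1 : 1 ≤ M := one_le_pow₀ one_le_two
  have hI0 := influence_nonneg (P := P) d f Q
  have hIM := influence_le (P := P) d hf1 Q
  have hD1 : (1 : ℝ) ≤ 2 ^ d := one_le_pow₀ one_le_two
  have hDM : (2 : ℝ) ^ d ≤ M := pow_le_pow_right₀ one_le_two hd
  set D : ℝ := 2 ^ d with hD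
  have hD4 : (4 : ℝ) ^ d = D ^ 2 := by rw [hD, ← pow_mul, mul_comm, pow_mul]; norm_num
  -- Without `η` both halves equal `D δ I`: the first is `4 ^ d · s δ²`, the second `t I²`. The
  -- shift by `η` keeps `t` bounded where the influence vanishes.
  set s : Ω → ℝ := fun ω => (I ω + η) / (D * δ) with hs
  set t : Ω → ℝ := fun ω => (D * δ) / (I ω + η) with ht
  have hIη : ∀ ω, 0 < I ω + η := fun ω => by have := hI0 ω; linarith
  have hDδ : 0 < D * δ := by positivity
  have hIdep := dep_influence (P := P) d f Q
  have hsdep : P.Dep Q s := fun ω ω' hω => by simp only [hs, hI, hIdep ω ω' hω]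
  have htdep : P.Dep Q t := fun ω ω' hω => by simp only [ht, hI, hIdep ω ω' hω]
  have hs0 : ∀ ω, 0 < s ω := fun ω => div_pos (hIη ω) hDδ
  have ht0 : ∀ ω, 0 < t ω := fun ω => div_pos hDδ (hIη ω)
  have hst : ∀ ω, s ω * t ω = 1 := fun ω => by
    have := (hIη ω).ne'
    simp only [hs, ht]; field_simp
  have hsB : ∀ ω, |s ω| ≤ 2 * M ^ 3 / (D * δ) := fun ω => by
    rw [abs_of_pos (hs0 ω)]
    refine div_le_div_of_nonneg_right ?_ hDδ.le
    have := hIM ω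
    have := one_le_pow₀ (n := 3) hM1
    linarith
  have htB : ∀ ω, |t ω| ≤ M / η := fun ω => by
    rw [abs_of_pos (ht0 ω)]
    refine div_le_div₀ (by positivity) ?_ hη (by have := hI0 ω; linarith)
    nlinarith
  -- arithmetic-geometric mean inequality for each pair
  have key : ∀ x ∈ lowPairs d Q,
      P.ex (P.es Q (x.1 \ x.2 ∪ x.2 \ x.1) f * (P.es ∅ x.1 f * P.es ∅ x.2 f)) ≤
      1 / 2 * P.ex (s * P.es Q (x.1 \ x.2 ∪ x.2 \ x.1) f ^ 2) + 1 / 2 *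
        (P.ex (t * (P.cex Q (P.es ∅ x.1 f ^ 2) * P.cex Q (P.es ∅ x.2 f ^ 2))) +
        M / η * M ^ 4 * e * μ) := by
    intro x hx
    set hh := P.es Q (x.1 \ x.2 ∪ x.2 \ x.1) f
    have hQ := (mem_lowPairs.1 hx).2
    have h1 := ex_mul_sq_mul_sq_le he (by positivity) h x.1 x.2 hf1 (hQ.symm ▸ htdep) htB
    rw [hQ] at h1
    have h2 : P.ex (hh * (P.es ∅ x.1 f * P.es ∅ x.2 f)) ≤
        P.ex ((1 / 2 : ℝ) • (s * hh ^ 2) +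
          (1 / 2 : ℝ) • (t * (P.es ∅ x.1 f ^ 2 * P.es ∅ x.2 f ^ 2))) := by
      refine ex_mono fun ω => ?_
      simp only [Pi.add_apply, Pi.smul_apply, Pi.mul_apply, Pi.pow_apply, smul_eq_mul]
      have h3 : t ω = (s ω)⁻¹ := eq_inv_of_mul_eq_one_right (hst ω)
      set F := P.es ∅ x.1 f ω * P.es ∅ x.2 f ω
      have h4 : P.es ∅ x.1 f ω ^ 2 * P.es ∅ x.2 f ω ^ 2 = F ^ 2 := by simp only [F]; ring
      rw [h4]
      have h5 : 0 ≤ t ω * (s ω * hh ω - F) ^ 2 := mul_nonneg (ht0 ω).le (sq_nonneg _)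
      have h6 : t ω * (s ω * hh ω - F) ^ 2 = s ω * hh ω ^ 2 * (s ω * t ω) - 2 * (s ω * t ω) *
        (hh ω * F) + t ω * F ^ 2 := by ring
      rw [hst ω] at h6
      linarith
    rw [map_add, map_smul, map_smul, smul_eq_mul, smul_eq_mul] at h2
    linarith
  refine (Finset.sum_le_sum key).trans ?_
  rw [Finset.sum_add_distrib, ← Finset.mul_sum, ← Finset.mul_sum, Finset.sum_add_distrib,
    Finset.sum_const, nsmul_eq_mul]
  -- the first family of terms
  have hA : ∑ x ∈ lowPairs d Q, P.ex (s * P.es Q (x.1 \ x.2 ∪ x.2 \ x.1) f ^ 2) ≤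
      D * δ * P.ex I + μ * (M * (η / δ) + 2 * M ^ 9 * (e / δ)) := by
    have h1 := sum_lowPairs_symmDiff_le d Q (a := fun U => P.ex (s * P.es Q U f ^ 2))
      fun U => ex_nonneg fun ω => mul_nonneg (hs0 ω).le (sq_nonneg (P.es Q U f ω))
    have h2 := abs_ex_mul_sum_es_sq_sub_le (P := P) he (by positivity) h (Q := Q)
      (𝒰 := Qᶜ.powerset) (fun U hU => by
        rw [Finset.mem_powerset] at hU
        exact Finset.disjoint_left.2 fun i hi => Finset.mem_compl.1 (hU hi)) hsdep hsB f
    have h3 : ∑ U ∈ Qᶜ.powerset, P.es Q U f = f := by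
      rw [← LinearMap.sum_apply, sum_es, Finset.union_compl, cex_of_dep hfdep]
    -- The squared components add up to `f² = f`, and `s` depends on `Q` only, so `f` may be
    -- averaged over the fibres of `Q`. Globalness then applies pointwise.
    rw [h3, hff, ← ex_mul_cex hsdep] at h2
    have h4 : P.ex (s * P.cex Q f) ≤ P.ex ((δ / D) • I + (η / (D * δ)) • P.cex Q f) := by
      refine ex_mono fun ω => ?_
      simp only [Pi.add_apply, Pi.smul_apply, Pi.mul_apply, smul_eq_mul, hs]
      have h5 : (I ω + η) / (D * δ) * P.cex Q f ω =
        I ω * P.cex Q f ω / (D * δ) + η / (D * δ) * P.cex Q f ω := by ring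
      have h6 : I ω * P.cex Q f ω / (D * δ) ≤ I ω * δ ^ 2 / (D * δ) :=
        div_le_div_of_nonneg_right (mul_le_mul_of_nonneg_left (hglob ω) (hI0 ω)) hDδ.le
      have h7 : I ω * δ ^ 2 / (D * δ) = δ / D * I ω := by field_simp
      linarith
    rw [map_add, map_smul, map_smul, ex_cex, ← hμ, smul_eq_mul, smul_eq_mul] at h4
    have h5 := (abs_le.1 h2).1
    rw [hD4] at h1
    refine h1.trans ?_
    have h6 : ∑ U ∈ Qᶜ.powerset, P.ex (s * P.es Q U f ^ 2) ≤
      δ / D * P.ex I + η / (D * δ) * μ + 2 * M ^ 3 / (D * δ) * M ^ 4 * e * μ := by linarith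
    refine (mul_le_mul_of_nonneg_left h6 (sq_nonneg D)).trans ?_
    have h7 : D ^ 2 * (δ / D * P.ex I + η / (D * δ) * μ + 2 * M ^ 3 / (D * δ) * M ^ 4 * e * μ) =
      D * δ * P.ex I + μ * (D * (η / δ) + 2 * (D * M ^ 7) * (e / δ)) := by
      field_simp
      ring
    rw [h7]
    gcongr
    calc D * M ^ 7 ≤ M ^ 2 * M ^ 7 := by
          gcongr; exact hDM.trans (le_self_pow₀ hM1 (by norm_num))
      _ = M ^ 9 := by ring
  -- the second family of terms
  have hB : ∑ x ∈ lowPairs d Q,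
      P.ex (t * (P.cex Q (P.es ∅ x.1 f ^ 2) * P.cex Q (P.es ∅ x.2 f ^ 2))) ≤
      D * δ * P.ex I := by
    rw [← map_sum, ← smul_eq_mul, ← map_smul]
    refine ex_mono fun ω => ?_
    simp only [Finset.sum_apply, Pi.smul_apply, Pi.mul_apply, smul_eq_mul]
    rw [← Finset.mul_sum]
    refine (mul_le_mul_of_nonneg_left (sum_lowPairs_mul_le_influence_sq d f Q ω)
      (ht0 ω).le).trans ?_
    simp only [ht]
    rw [div_mul_eq_mul_div, div_le_iff₀ (hIη ω), mul_assoc (D * δ)]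
    refine mul_le_mul_of_nonneg_left ?_ hDδ.le
    have := hI0 ω
    change I ω ^ 2 ≤ _
    nlinarith
  have hC : ((lowPairs d Q).card : ℝ) * (M / η * M ^ 4 * e * μ) ≤ M ^ 7 * (e / η) * μ := by
    calc _ ≤ M ^ 2 * (M / η * M ^ 4 * e * μ) := by
          gcongr; exact card_lowPairs_le d Q
      _ = _ := by ring
  have hC0 : 0 ≤ M ^ 7 * (e / η) * μ := by positivity
  have hC1 : 0 ≤ μ * (M * (η / δ)) := by positivity
  linarith

/-- The triple product of `f` with the square of its low-degree part is small when `f` is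
global. -/
theorem ex_mul_low_sq_le {e δ η : ℝ} (he : 0 ≤ e) (hδ : 0 < δ) (hδ1 : δ ≤ 1)
    (hη : 0 < η) (hη1 : η ≤ 1)
    (h : P.NearProduct e) {d : ℕ} (hd : d ≤ Fintype.card ι) {f : Ω → ℝ}
    (hf : ∀ ω, f ω = 0 ∨ f ω = 1) (hfdep : P.Dep Finset.univ f)
    (hglob : ∀ Q : Finset ι, Q.card ≤ d → ∀ ω, P.cex Q f ω ≤ δ ^ 2) :
    P.ex (f * (∑ S ∈ lowSets ι d, P.es ∅ S f) ^ 2) ≤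
      4 ^ d * δ * ∑ S ∈ lowSets ι d, P.ex (P.es ∅ S f ^ 2) + P.nrm f ^ 2 *
      ((2 ^ Fintype.card ι) ^ 2 * (η / δ) + (2 ^ Fintype.card ι) ^ 10 * (e / δ) +
        (2 ^ Fintype.card ι) ^ 8 * (e / η) + (2 ^ Fintype.card ι) ^ 5 * e) := by
  have hf1 : ∀ ω, |f ω| ≤ 1 := fun ω => by rcases hf ω with h | h <;> simp [h]
  have h1 : P.ex (f * (∑ S ∈ lowSets ι d, P.es ∅ S f) ^ 2) =
      ∑ x ∈ lowSets ι d ×ˢ lowSets ι d, P.ex (f * (P.es ∅ x.1 f * P.es ∅ x.2 f)) := by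
    rw [sq, Finset.sum_mul_sum, ← Finset.sum_product', Finset.mul_sum, map_sum]
  have h2 : ∑ x ∈ lowSets ι d ×ˢ lowSets ι d, P.ex (f * (P.es ∅ x.1 f * P.es ∅ x.2 f)) ≤
      ∑ x ∈ lowSets ι d ×ˢ lowSets ι d,
        P.ex (P.es (x.1 ∩ x.2) (x.1 \ x.2 ∪ x.2 \ x.1) f * (P.es ∅ x.1 f * P.es ∅ x.2 f)) +
      (2 ^ Fintype.card ι) ^ 2 * ((2 ^ Fintype.card ι) ^ 3 * e * P.nrm f ^ 2) := by
    refine (Finset.sum_le_sum fun x _ => ex_mul_es_mul_es_le he h x.1 x.2 hf1).trans ?_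
    rw [Finset.sum_add_distrib, Finset.sum_const, nsmul_eq_mul, Finset.card_product]
    have h3 := card_family_le (lowSets ι d)
    push_cast
    rw [sq (2 ^ Fintype.card ι : ℝ)]
    gcongr
  have h3 : ∑ x ∈ lowSets ι d ×ˢ lowSets ι d,
        P.ex (P.es (x.1 ∩ x.2) (x.1 \ x.2 ∪ x.2 \ x.1) f * (P.es ∅ x.1 f * P.es ∅ x.2 f)) =
      ∑ Q ∈ lowSets ι d, ∑ x ∈ lowPairs d Q,
        P.ex (P.es Q (x.1 \ x.2 ∪ x.2 \ x.1) f * (P.es ∅ x.1 f * P.es ∅ x.2 f)) := by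
    rw [← Finset.sum_fiberwise_of_maps_to (t := lowSets ι d) (g := fun x => x.1 ∩ x.2)]
    · refine Finset.sum_congr rfl fun Q _ => Finset.sum_congr rfl fun x hx => ?_
      rw [(Finset.mem_filter.1 hx).2]
    · intro x hx
      rw [Finset.mem_product, mem_lowSets, mem_lowSets] at hx
      exact mem_lowSets.2 ((Finset.card_le_card Finset.inter_subset_left).trans hx.1)
  have h4 : ∀ Q ∈ lowSets ι d, _ := fun Q hQ =>
    ex_triple_le_of_inter_eq (P := P) he hδ hδ1 hη hη1 h hd hf hfdep (hglob Q (mem_lowSets.1 hQ))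
  have h5 := Finset.sum_le_sum h4
  rw [Finset.sum_add_distrib, ← Finset.mul_sum, Finset.sum_const, nsmul_eq_mul] at h5
  have h6 := mul_le_mul_of_nonneg_left (sum_ex_influence_le (P := P) d f)
    (by positivity : 0 ≤ 2 ^ d * δ)
  set E := P.nrm f ^ 2 * (2 ^ Fintype.card ι * (η / δ) + (2 ^ Fintype.card ι) ^ 9 * (e / δ) +
        (2 ^ Fintype.card ι) ^ 7 * (e / η)) with hE
  have h7 : ((lowSets ι d).card : ℝ) * E ≤ 2 ^ Fintype.card ι * E := by
    have : 0 ≤ E := by positivity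
    gcongr
    exact card_family_le _
  have h8 : (4 : ℝ) ^ d = 2 ^ d * 2 ^ d := by rw [← mul_pow]; norm_num
  rw [h1, h8]
  rw [h3] at h2
  rw [hE] at h7
  linarith

end CoordinateSpace

/-! ### The level inequality and the loss of norm on forgetting a coordinate. -/

namespace CoordinateSpace

theorem dep_one {Ω ι V : Type*} {P : CoordinateSpace Ω ι V} (S : Finset ι) : P.Dep S 1 := fun _ _ _ => rfl

variable {Ω ι V : Type*} [Fintype Ω] {P : CoordinateSpace Ω ι V} [DecidableEq ι] [Fintype ι]

/-- Expand the factor `f` into all its components; off-diagonal products are negligible by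
near-orthogonality. -/
theorem sum_ex_es_sq_le_ex_mul_low {e : ℝ} (he : 0 ≤ e) (h : P.NearProduct e) (d : ℕ)
    {f : Ω → ℝ} (hfdep : P.Dep Finset.univ f) :
    ∑ S ∈ lowSets ι d, P.ex (P.es ∅ S f ^ 2) ≤
      P.ex (f * ∑ S ∈ lowSets ι d, P.es ∅ S f) + (2 ^ Fintype.card ι) ^ 4 * e * P.nrm f ^ 2 := by
  set E := (2 ^ Fintype.card ι) ^ 2 * e * P.nrm f ^ 2 with hE
  have hE0 : 0 ≤ E := by positivity
  have h0 : ∑ T ∈ (Finset.univ : Finset ι).powerset, P.es ∅ T f = f := by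
    rw [← LinearMap.sum_apply, sum_es, Finset.empty_union, cex_of_dep hfdep]
  have h1 : ∀ S ∈ lowSets ι d, P.ex (P.es ∅ S f ^ 2) ≤
      P.ex (f * P.es ∅ S f) + 2 ^ Fintype.card ι * E := by
    intro S _
    have h2 : P.ex (f * P.es ∅ S f) = ∑ T ∈ (Finset.univ : Finset ι).powerset,
        P.ex (P.es ∅ T f * P.es ∅ S f) := by
      rw [← map_sum, ← Finset.sum_mul, h0]
    rw [← Finset.add_sum_erase _ _ (Finset.mem_powerset.2 (Finset.subset_univ S)), ← sq] at h2
    have h3 : |∑ T ∈ (Finset.univ : Finset ι).powerset.erase S, P.ex (P.es ∅ T f * P.es ∅ S f)| ≤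
        ((Finset.univ : Finset ι).powerset.erase S).card • E := by
      refine (Finset.abs_sum_le_sum_abs _ _).trans (Finset.sum_le_card_nsmul _ _ _ fun T hT => ?_)
      have := abs_ex_mul_es_mul_es_le he h (Q := ∅) (Finset.disjoint_empty_right T)
        (Finset.disjoint_empty_right S) (Finset.mem_erase.1 hT).1 (dep_one ∅) (B := 1)
        (fun ω => by simp) f
      rwa [one_mul, one_mul] at this
    rw [nsmul_eq_mul] at h3
    have h4 : (((Finset.univ : Finset ι).powerset.erase S).card : ℝ) * E ≤
        2 ^ Fintype.card ι * E := by gcongr; exact card_family_le _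
    have h5 := (abs_le.1 h3).1
    linarith
  refine (Finset.sum_le_sum h1).trans ?_
  rw [Finset.sum_add_distrib, Finset.sum_const, nsmul_eq_mul, Finset.mul_sum, map_sum]
  have h2 : ((lowSets ι d).card : ℝ) * (2 ^ Fintype.card ι * E) ≤
      2 ^ Fintype.card ι * (2 ^ Fintype.card ι * E) := by gcongr; exact card_family_le _
  rw [hE] at h2 ⊢
  linarith

/-- Level inequality: a global function has little weight on low degrees. -/
theorem sum_low_ex_es_sq_le {e δ η τ : ℝ} (he : 0 ≤ e) (hδ : 0 < δ) (hδ1 : δ ≤ 1)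
    (hη : 0 < η) (hη1 : η ≤ 1) (hτ : 0 < τ)
    (h : P.NearProduct e) {d : ℕ} (hd : d ≤ Fintype.card ι) {f : Ω → ℝ}
    (hf : ∀ ω, f ω = 0 ∨ f ω = 1) (hfdep : P.Dep Finset.univ f)
    (hglob : ∀ Q : Finset ι, Q.card ≤ d → ∀ ω, P.cex Q f ω ≤ δ ^ 2)
    (hδτ : 4 ^ d * δ ≤ τ / 4) (heτ : (2 ^ Fintype.card ι) ^ 4 * e ≤ τ / 8)
    (hητ : (2 ^ Fintype.card ι) ^ 2 * (η / δ) + (2 ^ Fintype.card ι) ^ 10 * (e / δ) +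
      (2 ^ Fintype.card ι) ^ 8 * (e / η) + (2 ^ Fintype.card ι) ^ 5 * e ≤ τ ^ 2 / 4) :
    ∑ S ∈ lowSets ι d, P.ex (P.es ∅ S f ^ 2) ≤ τ * P.nrm f ^ 2 := by
  have h1 := sum_ex_es_sq_le_ex_mul_low he h d hfdep
  have h2 := ex_mul_low_sq_le he hδ hδ1 hη hη1 h hd hf hfdep hglob
  set g := ∑ S ∈ lowSets ι d, P.es ∅ S f
  set w := ∑ S ∈ lowSets ι d, P.ex (P.es ∅ S f ^ 2)
  set μ := P.nrm f ^ 2 with hμ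
  have hμ0 : 0 ≤ μ := sq_nonneg _
  have hff : f * f = f := by ext ω; rcases hf ω with h | h <;> simp [h]
  -- Cauchy–Schwarz for `f * (f * g)`, using `f * f = f`.
  have h3 : P.ex (f * g) ^ 2 ≤ μ * P.ex (f * g ^ 2) := by
    have h4 := abs_ex_mul_le (P := P) f (f * g)
    rw [← mul_assoc, hff] at h4
    have h5 : P.nrm (f * g) ^ 2 = P.ex (f * g ^ 2) := by
      rw [nrm_sq, mul_pow, sq f, hff]
    rw [← h5, hμ, ← mul_pow, ← sq_abs]
    exact pow_le_pow_left₀ (abs_nonneg _) h4 2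
  by_contra! hw
  have h6 : P.ex (f * g ^ 2) ≤ τ / 4 * w + μ * (τ ^ 2 / 4) := by
    have hw0 : 0 ≤ w := (mul_nonneg hτ.le hμ0).trans hw.le
    refine h2.trans (add_le_add ?_ ?_) <;> gcongr
  have h7 : 7 / 8 * w ≤ P.ex (f * g) := by
    have : (2 ^ Fintype.card ι) ^ 4 * e * μ ≤ τ / 8 * μ := by gcongr
    linarith
  have hw0 : 0 < w := (mul_nonneg hτ.le hμ0).trans_lt hw
  have h8 : (7 / 8 * w) ^ 2 ≤ P.ex (f * g) ^ 2 := pow_le_pow_left₀ (by positivity) h7 2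
  have h9 : μ * P.ex (f * g ^ 2) ≤ μ * (τ / 4 * w + μ * (τ ^ 2 / 4)) := by gcongr
  have h10 : μ * (τ / 4 * w + μ * (τ ^ 2 / 4)) = 1 / 4 * (τ * μ) * w + 1 / 4 * (τ * μ) ^ 2 := by
    ring
  have h11 : (τ * μ) * w ≤ w ^ 2 := by rw [sq]; gcongr
  have h12 : (τ * μ) ^ 2 ≤ w ^ 2 := pow_le_pow_left₀ (mul_nonneg hτ.le hμ0) hw.le 2
  -- If `w > τ μ` then `(7/8)² w² ≤ w²/4 + w²/4`, which is false since `49/64 > 1/2`.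
  nlinarith [sq_pos_of_pos hw0]

/-- If `f` has little weight on low degrees then forgetting a random coordinate decreases its norm
significantly. -/
theorem sum_nrm_cex_compl_sq_le {e : ℝ} (he : 0 ≤ e) (h : P.NearProduct e) {d : ℕ}
    (hd : d < Fintype.card ι) {f : Ω → ℝ} (hfdep : P.Dep Finset.univ f)
    (hlow : ((d : ℝ) + 1) * ∑ S ∈ lowSets ι d, P.ex (P.es ∅ S f ^ 2) ≤ 1 / 4 * P.nrm f ^ 2)
    (hsmall : (2 ^ Fintype.card ι) ^ 4 * e ≤ 1 / (32 * (Fintype.card ι : ℝ))) :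
    ∑ i, P.nrm (P.cex {i}ᶜ f) ^ 2 ≤ ((Fintype.card ι : ℝ) - d) * P.nrm f ^ 2 := by
  set k : ℝ := (Fintype.card ι : ℝ) with hk
  set μ := P.nrm f ^ 2 with hμ
  have hμ0 : 0 ≤ μ := sq_nonneg _
  set W : Finset ι → ℝ := fun S => P.ex (P.es ∅ S f ^ 2) with hW
  have hW0 : ∀ S, 0 ≤ W S := fun S => ex_sq_nonneg _
  have hdk : (d : ℝ) + 1 ≤ k := by rw [hk]; exact_mod_cast hd
  have hd0 : (0 : ℝ) ≤ d := Nat.cast_nonneg d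
  have hk0 : 0 < k := by linarith
  have herr : (2 ^ Fintype.card ι) ^ 4 * e * μ ≤ 1 / (32 * k) * μ := by gcongr
  have happrox : ∀ T : Finset ι, |P.nrm (P.cex T f) ^ 2 - ∑ S ∈ T.powerset, W S| ≤
      1 / (32 * k) * μ := fun T => by
    have h1 := abs_ex_mul_sum_es_sq_sub_le he zero_le_one h (Q := ∅) (𝒰 := T.powerset)
      (fun U _ => Finset.disjoint_empty_right U) (dep_one ∅) (fun ω => by simp) f
    rw [← LinearMap.sum_apply, sum_es, Finset.empty_union] at h1
    simp only [one_mul] at h1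
    rw [nrm_sq]
    exact h1.trans herr
  have htot : ∑ S, W S ≤ μ + 1 / (32 * k) * μ := by
    have h1 := (abs_le.1 (happrox Finset.univ)).1
    rw [cex_of_dep hfdep, Finset.powerset_univ] at h1
    linarith
  have h1 : ∑ i, P.nrm (P.cex {i}ᶜ f) ^ 2 ≤
      ∑ i : ι, (∑ S ∈ ({i}ᶜ : Finset ι).powerset, W S + 1 / (32 * k) * μ) :=
    Finset.sum_le_sum fun i _ => by have := (abs_le.1 (happrox {i}ᶜ)).2; linarith
  rw [Finset.sum_add_distrib, Finset.sum_const, nsmul_eq_mul, Finset.card_univ, ← hk,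
    Finset.sum_comm' (t' := Finset.univ) (s' := fun S => Sᶜ)] at h1
  swap
  · intro i S
    simp
  -- The component at `S` survives forgetting `i` exactly when `i ∉ S`, that is, for `k - |S|`
  -- positions. This is at most `k - d - 1` unless `|S| ≤ d`, where the excess is at most `d + 1`.
  have h2 : ∀ S : Finset ι, ∑ _i ∈ Sᶜ, W S ≤
      (k - d - 1) * W S + if S ∈ lowSets ι d then (d + 1) * W S else 0 := by
    intro S
    rw [Finset.sum_const, nsmul_eq_mul, Finset.card_compl, Nat.cast_sub (Finset.card_le_univ S),
      ← hk]
    split_ifs with hS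
    · have : 0 ≤ (S.card : ℝ) * W S := mul_nonneg (Nat.cast_nonneg _) (hW0 S)
      linarith
    · rw [mem_lowSets, not_le] at hS
      have : (d : ℝ) + 1 ≤ S.card := by exact_mod_cast hS
      rw [add_zero]
      exact mul_le_mul_of_nonneg_right (by linarith) (hW0 S)
  have h3 := Finset.sum_le_sum fun S (_ : S ∈ Finset.univ) => h2 S
  rw [Finset.sum_add_distrib, ← Finset.mul_sum, Finset.sum_ite_mem, Finset.univ_inter,
    ← Finset.mul_sum] at h3
  have h4 : (k - d - 1) * ∑ S, W S ≤ (k - d - 1) * (μ + 1 / (32 * k) * μ) :=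
    mul_le_mul_of_nonneg_left htot (by linarith)
  have h5 : (k - d - 1) * (1 / (32 * k) * μ) ≤ k * (1 / (32 * k) * μ) :=
    mul_le_mul_of_nonneg_right (by linarith) (by positivity)
  have h6 : k * (1 / (32 * k) * μ) = 1 / 32 * μ := by field_simp
  linarith

/-- The left side is `(1 / (50 d)) ^ d ≤ 1 / (50 d)`. This is where the constant in `(200 d) ^ d` is
used: it gives `4 ^ d δ ≤ τ / 4` for `τ = 1 / (4 (d + 1))`. -/
theorem four_pow_mul_inv_pow_le {d : ℕ} (hd : 1 ≤ d) :
    (4 : ℝ) ^ d * ((200 * (d : ℝ)) ^ d)⁻¹ ≤ 1 / (16 * ((d : ℝ) + 1)) := by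
  have hd' : (1 : ℝ) ≤ d := by exact_mod_cast hd
  rw [← inv_pow, ← mul_pow]
  have h1 : 4 * (200 * (d : ℝ))⁻¹ = 1 / (50 * d) := by field_simp; norm_num
  rw [h1]
  have h2 : 1 / (50 * (d : ℝ)) ≤ 1 := by
    rw [div_le_one (by positivity)]; linarith
  refine (pow_le_of_le_one (by positivity) h2 (by omega)).trans ?_
  exact one_div_le_one_div_of_le (by positivity) (by linarith)

/-- Choice of parameters: `τ = 1 / (4 (d + 1))` leaves the low degrees a contribution of at most
`‖f‖² / 4`, and each of the four errors in the level inequality is at most `1 / (256 k²)`, so that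
together they stay below `τ² / 4`. -/
theorem sum_nrm_cex_compl_sq_le_of_global {e : ℝ} (he : 0 ≤ e) (h : P.NearProduct e) {d : ℕ}
    (hd1 : 1 ≤ d) (hd : d < Fintype.card ι) {f : Ω → ℝ} (hf : ∀ ω, f ω = 0 ∨ f ω = 1)
    (hfdep : P.Dep Finset.univ f)
    (hglob : ∀ Q : Finset ι, Q.card ≤ d → ∀ ω, P.cex Q f ω ≤ (((200 * (d : ℝ)) ^ d)⁻¹) ^ 2)
    (hsmall : e ≤ ((200 * (Fintype.card ι : ℝ)) ^ Fintype.card ι)⁻¹ /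
      (65536 * (Fintype.card ι : ℝ) ^ 4 * (2 ^ Fintype.card ι) ^ 10)) :
    ∑ i, P.nrm (P.cex {i}ᶜ f) ^ 2 ≤ ((Fintype.card ι : ℝ) - d) * P.nrm f ^ 2 := by
  set k : ℝ := (Fintype.card ι : ℝ) with hk
  set M : ℝ := 2 ^ Fintype.card ι with hM
  set δ : ℝ := ((200 * (d : ℝ)) ^ d)⁻¹ with hδ
  -- A lower bound for `δ` that is free of `d`, so that the condition on `e` depends on `k` alone.
  set κ : ℝ := ((200 * k) ^ Fintype.card ι)⁻¹ with hκ
  have hM1 : 1 ≤ M := one_le_pow₀ one_le_two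
  have hd' : (1 : ℝ) ≤ d := by exact_mod_cast hd1
  have hdk : (d : ℝ) + 1 ≤ k := by rw [hk]; exact_mod_cast hd
  have hk1 : 1 ≤ k := by linarith
  have hδ0 : 0 < δ := by positivity
  have hκ0 : 0 < κ := by positivity
  have hδ1 : δ ≤ 1 := inv_le_one_of_one_le₀ (one_le_pow₀ (by linarith))
  have hκδ : κ ≤ δ := by
    refine inv_anti₀ (by positivity) ?_
    calc (200 * (d : ℝ)) ^ d ≤ (200 * k) ^ d := by gcongr; linarith
      _ ≤ _ := pow_le_pow_right₀ (by linarith) hd.le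
  -- Chosen so that `M ^ 2 * (η / κ) = 1 / (256 k ^ 2)`; the error `e / η` then dictates the bound
  -- on `e`.
  set η : ℝ := κ / (256 * k ^ 2 * M ^ 2) with hη
  have hη0 : 0 < η := by positivity
  have hη1 : η ≤ 1 := by
    rw [hη, div_le_one (by positivity)]
    have h1 : (1 : ℝ) ≤ k ^ 2 * M ^ 2 := one_le_mul_of_one_le_of_one_le (one_le_pow₀ hk1)
      (one_le_pow₀ hM1)
    linarith
  have e1 : e ≤ κ / (65536 * k ^ 4 * M ^ 10) := hsmall
  rw [le_div_iff₀ (by positivity)] at e1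
  have hk2 : 1 ≤ k ^ 2 := one_le_pow₀ hk1
  have b2 : M ^ 10 * e ≤ κ / (65536 * k ^ 4) := by
    rw [le_div_iff₀ (by positivity)]; linarith
  have b2' : κ / (65536 * k ^ 4) ≤ κ / (256 * k ^ 2) := by
    refine div_le_div_of_nonneg_left hκ0.le (by positivity) ?_
    nlinarith
  have b1 : M ^ 2 * (η / δ) ≤ 1 / (256 * k ^ 2) := by
    calc M ^ 2 * (η / δ) ≤ M ^ 2 * (η / κ) := by gcongr
      _ = _ := by rw [hη]; field_simp
  have b3 : M ^ 10 * (e / δ) ≤ 1 / (256 * k ^ 2) := by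
    calc M ^ 10 * (e / δ) ≤ M ^ 10 * (e / κ) := by gcongr
      _ = M ^ 10 * e / κ := by ring
      _ ≤ κ / (256 * k ^ 2) / κ := by gcongr; exact b2.trans b2'
      _ = _ := by field_simp
  have b4 : M ^ 8 * (e / η) ≤ 1 / (256 * k ^ 2) := by
    calc M ^ 8 * (e / η) = M ^ 10 * e * (256 * k ^ 2) / κ := by rw [hη]; field_simp
      _ ≤ κ / (65536 * k ^ 4) * (256 * k ^ 2) / κ := by gcongr
      _ = _ := by field_simp; norm_num
  have hκ1 : κ ≤ 1 := hκδ.trans hδ1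
  have b5 : M ^ 10 * e ≤ 1 / (256 * k ^ 2) := by
    refine (b2.trans b2').trans ?_
    gcongr
  have b6 : M ^ 5 * e ≤ 1 / (256 * k ^ 2) := by
    refine le_trans ?_ b5
    gcongr
    norm_num
  have b7 : M ^ 4 * e ≤ 1 / (32 * k) := by
    calc M ^ 4 * e ≤ M ^ 10 * e := by
          gcongr
          norm_num
      _ ≤ _ := b5
      _ ≤ _ := by
        refine one_div_le_one_div_of_le (by positivity) ?_
        nlinarith
  refine sum_nrm_cex_compl_sq_le he h hd hfdep ?_ b7
  have hτ0 : 0 < 1 / (4 * ((d : ℝ) + 1)) := by positivity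
  have h1 := sum_low_ex_es_sq_le (τ := 1 / (4 * ((d : ℝ) + 1))) he hδ0 hδ1 hη0 hη1 hτ0 h hd.le hf
    hfdep hglob ?_ ?_ ?_
  · calc ((d : ℝ) + 1) * ∑ S ∈ lowSets ι d, P.ex (P.es ∅ S f ^ 2) ≤
        ((d : ℝ) + 1) * (1 / (4 * ((d : ℝ) + 1)) * P.nrm f ^ 2) := by gcongr
      _ = _ := by field_simp
  · refine (four_pow_mul_inv_pow_le hd1).trans (le_of_eq ?_)
    field_simp; norm_num
  · refine b7.trans ?_
    calc 1 / (32 * k) ≤ 1 / (32 * ((d : ℝ) + 1)) := by gcongr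
      _ = _ := by field_simp; norm_num
  · have h2 : 1 / (64 * k ^ 2) ≤ (1 / (4 * ((d : ℝ) + 1))) ^ 2 / 4 := by
      calc 1 / (64 * k ^ 2) ≤ 1 / (64 * ((d : ℝ) + 1) ^ 2) := by gcongr
        _ = _ := by field_simp; norm_num
    have h3 : 1 / (64 * k ^ 2) = 4 * (1 / (256 * k ^ 2)) := by field_simp; norm_num
    linarith

end CoordinateSpace

/-! ### From eigenvalue bounds to contraction of mean-zero functions. -/

/-- A symmetric operator whose eigenvalues are at most `ε` in absolute value has norm at most
`ε`. -/
theorem LinearMap.IsSymmetric.norm_sq_apply_le {E : Type*} [NormedAddCommGroup E]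
    [InnerProductSpace ℝ E] [FiniteDimensional ℝ E] {T : E →ₗ[ℝ] E} (hT : T.IsSymmetric) {ε : ℝ}
    (h : ∀ (r : ℝ) (x : E), x ≠ 0 → T x = r • x → |r| ≤ ε) (x : E) :
    ‖T x‖ ^ 2 ≤ ε ^ 2 * ‖x‖ ^ 2 := by
  set b := hT.eigenvectorBasis rfl with hb
  rw [← b.repr.norm_map (T x), ← b.repr.norm_map x, EuclideanSpace.norm_sq_eq,
    EuclideanSpace.norm_sq_eq, Finset.mul_sum]
  refine Finset.sum_le_sum fun i _ => ?_
  rw [hT.eigenvectorBasis_apply_self_apply rfl x i, norm_mul, mul_pow]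
  refine mul_le_mul_of_nonneg_right ?_ (sq_nonneg _)
  refine pow_le_pow_left₀ (norm_nonneg _) ?_ 2
  exact h _ _ (b.toBasis.ne_zero i |> fun h => by simpa using h) (hT.apply_eigenvectorBasis rfl i)

/-- A reversible random walk whose nontrivial eigenvalues are at most `ε` in absolute value
contracts functions of mean zero by the factor `ε`. -/
theorem sum_mul_walk_sq_le {N : Type*} [Fintype N] {m : N → ℝ} (hm : ∀ v, 0 < m v)
    {w : N → N → ℝ} (hw : ∀ u v, m u * w u v = m v * w v u) (hw1 : ∀ u, ∑ v, w u v = 1) {ε : ℝ}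
    (h : ∀ (r : ℝ) (f : N → ℝ), (∃ v, f v ≠ 0) → ∑ v, m v * f v = 0 →
      (∀ u, ∑ v, w u v * f v = r * f u) → |r| ≤ ε) {f : N → ℝ} (hf : ∑ v, m v * f v = 0) :
    ∑ u, m u * (∑ v, w u v * f v) ^ 2 ≤ ε ^ 2 * ∑ u, m u * f u ^ 2 := by
  classical
  have hs : ∀ v, 0 < √(m v) := fun v => Real.sqrt_pos.2 (hm v)
  have hs2 : ∀ v, √(m v) * √(m v) = m v := fun v => Real.mul_self_sqrt (hm v).le
  have hsq : ∀ v, √(m v) ^ 2 = m v := fun v => Real.sq_sqrt (hm v).le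
  -- Conjugating by `√m` turns reversibility into symmetry for the standard inner product. Mean zero
  -- becomes orthogonality to the vector `√m`, which is the invariant subspace `K` below.
  let A : EuclideanSpace ℝ N →ₗ[ℝ] EuclideanSpace ℝ N :=
    Matrix.toEuclideanLin (Matrix.of fun u v => √(m u) * w u v / √(m v))
  have hA : ∀ x u, A x u = ∑ v, √(m u) * w u v / √(m v) * x v := fun x u => by
    simp [A, Matrix.toEuclideanLin, Matrix.mulVec, dotProduct]
  have hsym : ∀ u v, √(m u) * w u v / √(m v) = √(m v) * w v u / √(m u) := fun u v => by
    rw [div_eq_div_iff (hs v).ne' (hs u).ne']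
    have := hw u v
    rw [← hs2, ← hs2 v] at this
    linarith
  have hAsym : A.IsSymmetric := by
    intro x y
    simp only [PiLp.inner_apply, hA, RCLike.inner_apply, conj_trivial, Finset.mul_sum,
      Finset.sum_mul]
    rw [Finset.sum_comm]
    refine Finset.sum_congr rfl fun u _ => Finset.sum_congr rfl fun v _ => ?_
    rw [hsym]; ring
  let K : Submodule ℝ (EuclideanSpace ℝ N) :=
    LinearMap.ker (∑ v, √(m v) • (EuclideanSpace.proj v : EuclideanSpace ℝ N →L[ℝ] ℝ)).toLinearMap
  have hK : ∀ x, x ∈ K ↔ ∑ v, √(m v) * x v = 0 := fun x => by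
    simp [K]
  have hAK : ∀ x ∈ K, A x ∈ K := fun x hx => by
    rw [hK] at hx ⊢
    simp only [hA, Finset.mul_sum]
    rw [Finset.sum_comm, ← hx]
    refine Finset.sum_congr rfl fun v _ => ?_
    have : ∀ u, √(m u) * (√(m u) * w u v / √(m v) * x v) = √(m v) * x v * w v u := fun u => by
      have h1 := hw u v
      have h2 := (hs v).ne'
      rw [← mul_assoc, ← mul_div_assoc, ← mul_assoc, hs2, h1]
      field_simp
      rw [hsq v]
      ring
    rw [Finset.sum_congr rfl fun u _ => this u, ← Finset.mul_sum, hw1, mul_one]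
  have hbound := (hAsym.restrict_invariant hAK).norm_sq_apply_le (ε := ε) fun r x hx hrx => by
    refine h r (fun v => x.1 v / √(m v)) ?_ ?_ fun u => ?_
    · by_contra! h0
      refine hx (Subtype.ext (PiLp.ext fun v => ?_))
      simpa [(hs v).ne'] using h0 v
    · rw [← (hK _).1 x.2]
      refine Finset.sum_congr rfl fun v _ => ?_
      have h2 := (hs v).ne'
      field_simp
      rw [hsq v]
      ring
    · have h1 : A x.1 u = r * x.1 u := by
        have := congrArg (fun y : K => y.1 u) hrx
        simpa using this
      rw [hA] at h1
      rw [← mul_div_assoc, ← h1, Finset.sum_div]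
      refine Finset.sum_congr rfl fun v _ => ?_
      have h2 := (hs u).ne'
      field_simp
  set x : EuclideanSpace ℝ N := WithLp.toLp 2 fun v => √(m v) * f v with hx
  have hxv : ∀ v, x v = √(m v) * f v := fun v => rfl
  have hxK : x ∈ K := by
    rw [hK, ← hf]
    refine Finset.sum_congr rfl fun v _ => ?_
    rw [hxv, ← mul_assoc, hs2]
  have h1 := hbound ⟨x, hxK⟩
  have h2 : ‖A x‖ ^ 2 ≤ ε ^ 2 * ‖x‖ ^ 2 := h1
  rw [EuclideanSpace.norm_sq_eq, EuclideanSpace.norm_sq_eq] at h2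
  have h3 : ∀ u, A x u = √(m u) * ∑ v, w u v * f v := fun u => by
    rw [hA, Finset.mul_sum]
    refine Finset.sum_congr rfl fun v _ => ?_
    have := (hs v).ne'
    rw [hxv]; field_simp
  simpa only [h3, hxv, Real.norm_eq_abs, sq_abs, mul_pow, hsq] using h2

/-! ### Ordered facets as a coordinate space. -/

namespace WeightedComplex

variable {V : Type*} {k : ℕ} (X : WeightedComplex V k)

/-- The top-dimensional faces with an ordering of their vertices. -/
abbrev Ordered := Σ τ : X.facets, (Fin k ≃ τ.1)

/-- The space of ordered top-dimensional faces; the coordinates are the vertices. -/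
def ordered : CoordinateSpace X.Ordered (Fin k) V where
  prob ω := X.weight ω.1
  prob_pos ω := X.weight_pos ω.1 ω.1.2
  coord ω i := ω.2 i

variable {X}

theorem card_of_mem_facets {τ : Finset V} (h : τ ∈ X.facets) : τ.card = k :=
  ((X.mem_facets τ).1 h).2

theorem mem_faces_of_mem_facets {τ : Finset V} (h : τ ∈ X.facets) : τ ∈ X.faces :=
  ((X.mem_facets τ).1 h).1

theorem mem_faces_of_subset {σ τ : Finset V} (hτ : τ ∈ X.faces) (h : σ ⊆ τ)
    (hσ : σ.Nonempty) : σ ∈ X.faces :=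
  (X.isRelLowerSet_faces hτ).2 h hσ

theorem coord_injective (ω : X.Ordered) : Function.Injective (X.ordered.coord ω) := fun _ _ h =>
  ω.2.injective (Subtype.ext h)

variable [DecidableEq V]

/-- The vertices in the positions `Q`. -/
def vertices (Q : Finset (Fin k)) (ω : X.Ordered) : Finset V := Q.image (X.ordered.coord ω)

theorem vertices_subset (Q : Finset (Fin k)) (ω : X.Ordered) : vertices Q ω ⊆ ω.1 := by
  intro v hv
  obtain ⟨i, _, rfl⟩ := Finset.mem_image.1 hv
  exact (ω.2 i).2

theorem vertices_insert (Q : Finset (Fin k)) (i : Fin k) (ω : X.Ordered) :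
    vertices (insert i Q) ω = insert (X.ordered.coord ω i) (vertices Q ω) := by
  simp [vertices]

theorem coord_mem_vertices {Q : Finset (Fin k)} {i : Fin k} {ω : X.Ordered} :
    X.ordered.coord ω i ∈ vertices Q ω ↔ i ∈ Q := by
  simp [vertices, (coord_injective ω).eq_iff]

theorem card_vertices (Q : Finset (Fin k)) (ω : X.Ordered) : (vertices Q ω).card = Q.card :=
  Finset.card_image_of_injective _ (coord_injective ω)

theorem vertices_congr {Q : Finset (Fin k)} {ω ω' : X.Ordered}
    (h : ∀ i ∈ Q, X.ordered.coord ω' i = X.ordered.coord ω i) :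
    vertices Q ω' = vertices Q ω := Finset.image_congr h

theorem isFace_vertices (Q : Finset (Fin k)) (ω : X.Ordered) : X.IsFace (vertices Q ω) := by
  rcases (vertices Q ω).eq_empty_or_nonempty with h | h
  · exact Or.inl h
  · exact Or.inr (mem_faces_of_subset (mem_faces_of_mem_facets ω.1.2) (vertices_subset Q ω) h)

theorem mass_nonneg (σ : Finset V) : 0 ≤ X.mass σ :=
  Finset.sum_nonneg fun τ hτ => (X.weight_pos τ (Finset.mem_filter.1 hτ).1).le

theorem mass_pos {σ τ : Finset V} (hτ : τ ∈ X.facets) (h : σ ⊆ τ) : 0 < X.mass σ :=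
  Finset.sum_pos (fun τ hτ => X.weight_pos τ (Finset.mem_filter.1 hτ).1)
    ⟨τ, Finset.mem_filter.2 ⟨hτ, h⟩⟩

theorem mass_eq_zero {σ : Finset V} (hσ : σ.Nonempty) (h : σ ∉ X.faces) : X.mass σ = 0 := by
  rw [mass, Finset.filter_false_of_mem, Finset.sum_empty]
  exact fun τ hτ hs => h (mem_faces_of_subset (mem_faces_of_mem_facets hτ) hs hσ)

/-- The number of orderings of a set with prescribed vertices in the positions `Q`. -/
theorem card_equiv_extending {τ : Finset V} (hτ : τ.card = k) (Q : Finset (Fin k)) {y : Fin k → V}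
    (hy : Set.InjOn y Q) (hyτ : Q.image y ⊆ τ) :
    (Finset.univ.filter fun e : Fin k ≃ τ => ∀ i ∈ Q, (e i : V) = y i).card =
      (k - Q.card).factorial := by
  -- Fix one admissible ordering `g`; the others differ from it by the permutations fixing `Q`
  -- pointwise.
  obtain ⟨g, hg⟩ := Finset.exists_equiv_extend_of_card_eq (by simpa using hτ.symm) hyτ hy
  have h1 : (Finset.univ.filter fun e : Fin k ≃ τ => ∀ i ∈ Q, (e i : V) = y i).card =
      Fintype.card {p : Equiv.Perm (Fin k) // ∀ i, ¬ i ∉ Q → p i = i} := by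
    rw [Fintype.card_subtype]
    refine Finset.card_bij' (fun e _ => e.trans g.symm) (fun p _ => p.trans g) ?_ ?_ ?_ ?_
    · intro e he
      simp only [Finset.mem_filter, Finset.mem_univ, true_and, not_not] at he ⊢
      intro i hi
      rw [Equiv.trans_apply, Equiv.symm_apply_eq]
      exact Subtype.ext ((he i hi).trans (hg i hi).symm)
    · intro p hp
      simp only [Finset.mem_filter, Finset.mem_univ, true_and, not_not] at hp ⊢
      intro i hi
      rw [Equiv.trans_apply, hp i hi, hg i hi]
    · intro e _; ext; simp
    · intro p _; ext; simp
  rw [h1, ← Fintype.card_congr (Equiv.Perm.subtypeEquivSubtypePerm (fun i : Fin k => i ∉ Q)),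
    Fintype.card_perm]
  simp [Fintype.card_subtype_compl]

/-- Every facet containing the prescribed vertices has the same number of admissible orderings, and
no other facet has any. -/
theorem sum_ordered_extending (Q : Finset (Fin k)) {y : Fin k → V} (hy : Set.InjOn y Q)
    (F : Finset V → ℝ) :
    ∑ ω : X.Ordered with ∀ i ∈ Q, X.ordered.coord ω i = y i, X.ordered.prob ω * F ω.1 =
      ((k - Q.card).factorial : ℝ) * ∑ τ ∈ X.facets with Q.image y ⊆ τ, X.weight τ * F τ := by
  rw [Finset.sum_filter, Fintype.sum_sigma]
  have h1 : ∀ τ : X.facets, (∑ e : Fin k ≃ τ.1,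
      if ∀ i ∈ Q, X.ordered.coord ⟨τ, e⟩ i = y i then X.ordered.prob ⟨τ, e⟩ * F τ else 0) =
      if Q.image y ⊆ τ.1 then ((k - Q.card).factorial : ℝ) * (X.weight τ * F τ) else 0 := by
    intro τ
    have h2 : (Finset.univ.filter fun e : Fin k ≃ τ.1 => ∀ i ∈ Q, X.ordered.coord ⟨τ, e⟩ i = y i) =
      Finset.univ.filter fun e : Fin k ≃ τ.1 => ∀ i ∈ Q, (e i : V) = y i :=
        Finset.filter_congr fun _ _ => Iff.rfl
    rw [← Finset.sum_filter, h2]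
    refine (Finset.sum_const (X.weight τ * F τ)).trans ?_
    rw [nsmul_eq_mul]
    split_ifs with h
    · rw [card_equiv_extending (card_of_mem_facets τ.2) Q hy h]
    · rw [Finset.filter_false_of_mem, Finset.card_empty, Nat.cast_zero, zero_mul]
      intro e _ he
      refine h fun v hv => ?_
      obtain ⟨i, hi, rfl⟩ := Finset.mem_image.1 hv
      rw [← he i hi]
      exact (e i).2
  rw [Finset.sum_congr rfl fun τ _ => h1 τ,
    Finset.sum_coe_sort X.facets (fun τ => if Q.image y ⊆ τ then
      ((k - Q.card).factorial : ℝ) * (X.weight τ * F τ) else 0), ← Finset.sum_filter,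
    Finset.mul_sum]

theorem sum_fiber (Q : Finset (Fin k)) (ω : X.Ordered) (F : Finset V → ℝ) :
    ∑ ω' ∈ X.ordered.fiber Q ω, X.ordered.prob ω' * F ω'.1 =
      ((k - Q.card).factorial : ℝ) *
        ∑ τ ∈ X.facets with vertices Q ω ⊆ τ, X.weight τ * F τ := by
  rw [vertices, ← sum_ordered_extending Q ((coord_injective ω).injOn) F]
  refine Finset.sum_congr ?_ fun _ _ => rfl
  ext ω'
  simp [CoordinateSpace.mem_fiber]

theorem sum_fiber_prob (Q : Finset (Fin k)) (ω : X.Ordered) :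
    ∑ ω' ∈ X.ordered.fiber Q ω, X.ordered.prob ω' =
      ((k - Q.card).factorial : ℝ) * X.mass (vertices Q ω) := by
  simpa [mass] using sum_fiber Q ω fun _ => 1

/-- The conditional expectation given the vertices in the positions `Q` is the expectation in
the link. -/
theorem cex_ordered (Q : Finset (Fin k)) (ω : X.Ordered) (F : Finset V → ℝ) :
    X.ordered.cex Q (fun ω => F ω.1) ω =
      ∑ τ ∈ X.facets with vertices Q ω ⊆ τ, X.weight τ / X.mass (vertices Q ω) * F τ := by
  rw [CoordinateSpace.cex_apply, sum_fiber, sum_fiber_prob, mul_div_mul_left _ _ (by positivity),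
    Finset.sum_div]
  exact Finset.sum_congr rfl fun τ _ => by ring

theorem mem_linkVertices {σ : Finset V} {v : V} :
    v ∈ X.linkVertices σ ↔ v ∉ σ ∧ insert v σ ∈ X.faces := by
  classical
  rw [linkVertices, Finset.mem_filter, and_iff_right_iff_imp]
  intro h
  obtain ⟨τ, hτ, hs⟩ := X.pure _ h.2
  exact Finset.mem_biUnion.2 ⟨τ, hτ, hs (Finset.mem_insert_self v σ)⟩

theorem coord_mem_linkVertices {R : Finset (Fin k)} {i : Fin k} (hi : i ∉ R) (ω : X.Ordered) :
    X.ordered.coord ω i ∈ X.linkVertices (vertices R ω) := by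
  rw [mem_linkVertices, coord_mem_vertices, ← vertices_insert]
  refine ⟨hi, (isFace_vertices (insert i R) ω).resolve_left ?_⟩
  rw [vertices_insert]
  exact (Finset.insert_nonempty _ _).ne_empty

/-- The law of the vertex in position `i`, given the vertices in the positions `R`. -/
theorem sum_fiber_coord {R : Finset (Fin k)} {i : Fin k} (hi : i ∉ R) (ω : X.Ordered)
    (G : V → ℝ) :
    ∑ ω' ∈ X.ordered.fiber R ω, X.ordered.prob ω' * G (X.ordered.coord ω' i) =
      ((k - R.card - 1).factorial : ℝ) *
        ∑ v ∈ X.linkVertices (vertices R ω), X.mass (insert v (vertices R ω)) * G v := by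
  have hmaps : ∀ ω' ∈ X.ordered.fiber R ω,
      X.ordered.coord ω' i ∈ X.linkVertices (vertices R ω) := fun ω' h => by
    rw [← vertices_congr (CoordinateSpace.mem_fiber.1 h)]
    exact coord_mem_linkVertices hi ω'
  rw [← Finset.sum_fiberwise_of_maps_to hmaps, Finset.mul_sum]
  refine Finset.sum_congr rfl fun v hv => ?_
  -- Points of the fibre with `v` in position `i` are the orderings prescribed by `y` on `insert i
  -- R`. Injectivity of `y` there holds because `v` lies outside `vertices R ω`.
  set y := Function.update (X.ordered.coord ω) i v with hy
  have hyR : ∀ j ∈ R, y j = X.ordered.coord ω j := fun j hj =>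
    Function.update_of_ne (fun h => hi (by rwa [← h])) _ _
  have hyi : y i = v := Function.update_self _ _ _
  have himg : (insert i R).image y = insert v (vertices R ω) := by
    rw [Finset.image_insert, hyi, vertices, Finset.image_congr hyR]
  have hinj : Set.InjOn y (insert i R : Finset (Fin k)) := by
    rw [← Finset.card_image_iff, himg, Finset.card_insert_of_notMem (mem_linkVertices.1 hv).1,
      card_vertices, Finset.card_insert_of_notMem hi]
  have h1 := sum_ordered_extending (X := X) (insert i R) hinj fun _ => 1
  rw [himg, Finset.card_insert_of_notMem hi] at h1
  simp only [mul_one] at h1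
  rw [Nat.sub_sub, ← mul_assoc, show X.mass (insert v (vertices R ω)) = ∑ τ ∈ X.facets with
    insert v (vertices R ω) ⊆ τ, X.weight τ from rfl, ← h1, Finset.sum_mul]
  refine Finset.sum_congr ?_ fun ω' hω' => ?_
  · ext ω'
    simp only [Finset.mem_filter, CoordinateSpace.mem_fiber, Finset.mem_univ, true_and,
      Finset.forall_mem_insert, hyi]
    rw [and_comm]
    exact and_congr_right fun _ => forall₂_congr fun j hj => by rw [hyR j hj]
  · have := (Finset.mem_filter.1 hω').2 i (Finset.mem_insert_self i R)
    rw [this, hyi]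

end WeightedComplex

/-! ### Spectral expansion of links gives pairwise near-independence. -/

namespace WeightedComplex

variable {V : Type*} [DecidableEq V] {k : ℕ} {X : WeightedComplex V k}

/-- Double counting: a facet containing `σ` has `k - |σ|` vertices outside `σ`. -/
theorem sum_mass_insert (σ : Finset V) :
    ∑ v ∈ X.linkVertices σ, X.mass (insert v σ) = ((k : ℝ) - σ.card) * X.mass σ := by
  simp only [mass]
  rw [Finset.sum_comm' (t' := X.facets.filter (σ ⊆ ·)) (s' := fun τ => τ \ σ), Finset.mul_sum]
  · refine Finset.sum_congr rfl fun τ hτ => ?_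
    rw [Finset.mem_filter] at hτ
    rw [Finset.sum_const, nsmul_eq_mul, Finset.card_sdiff_of_subset hτ.2,
      Nat.cast_sub (Finset.card_le_card hτ.2), card_of_mem_facets hτ.1]
  · intro v τ
    simp only [mem_linkVertices, Finset.mem_filter, Finset.mem_sdiff, Finset.insert_subset_iff]
    constructor
    · rintro ⟨⟨h1, -⟩, h3, h4, h5⟩
      exact ⟨⟨h4, h1⟩, h3, h5⟩
    · rintro ⟨⟨h4, h1⟩, h3, h5⟩
      exact ⟨⟨h1, mem_faces_of_subset (mem_faces_of_mem_facets h3)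
        (Finset.insert_subset h4 h5) (Finset.insert_nonempty v σ)⟩, h3, h4, h5⟩

theorem mass_insert_pos {σ : Finset V} {v : V} (h : v ∈ X.linkVertices σ) :
    0 < X.mass (insert v σ) := by
  obtain ⟨τ, hτ, hs⟩ := X.pure _ (mem_linkVertices.1 h).2
  exact mass_pos hτ hs

/-- Steps to a `v` outside the link of `insert u σ` have probability zero. The right side is the
form in which conditional expectations given one more vertex appear. -/
theorem sum_linkWalk_mul (σ : Finset V) (u : V) (G : V → ℝ) :
    ∑ v ∈ X.linkVertices σ, X.linkWalk σ u v * G v =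
      (∑ v ∈ X.linkVertices (insert u σ), X.mass (insert v (insert u σ)) * G v) /
        (((k : ℝ) - σ.card - 1) * X.mass (insert u σ)) := by
  have hsub : X.linkVertices (insert u σ) ⊆ X.linkVertices σ := fun v hv => by
    rw [mem_linkVertices] at hv ⊢
    exact ⟨fun h => hv.1 (Finset.mem_insert_of_mem h), mem_faces_of_subset hv.2
      (Finset.insert_subset_insert v (Finset.subset_insert u σ)) (Finset.insert_nonempty v σ)⟩
  rw [← Finset.sum_subset hsub, Finset.sum_div]
  · refine Finset.sum_congr rfl fun v hv => ?_
    have huv : u ≠ v := fun h => (mem_linkVertices.1 hv).1 (h ▸ Finset.mem_insert_self u σ)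
    rw [linkWalk, if_neg huv]
    ring
  · intro v hv hv'
    rw [linkWalk]
    split_ifs with huv
    · rw [zero_mul]
    · rw [mem_linkVertices, not_and] at hv'
      have h1 : v ∉ insert u σ := by
        rw [Finset.mem_insert, not_or]
        exact ⟨Ne.symm huv, (mem_linkVertices.1 hv).1⟩
      rw [mass_eq_zero (Finset.insert_nonempty _ _) (hv' h1), zero_div, zero_mul]

theorem sum_linkWalk {σ : Finset V} (hσ : σ.card + 2 ≤ k) {u : V} (hu : u ∈ X.linkVertices σ) :
    ∑ v ∈ X.linkVertices σ, X.linkWalk σ u v = 1 := by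
  have h1 := sum_linkWalk_mul (X := X) σ u fun _ => 1
  simp only [mul_one] at h1
  have h2 : (σ.card : ℝ) + 2 ≤ k := by exact_mod_cast hσ
  have h3 : ((k : ℝ) - σ.card - 1) ≠ 0 := by linarith
  rw [h1, sum_mass_insert, Finset.card_insert_of_notMem (mem_linkVertices.1 hu).1]
  push_cast
  rw [← sub_sub, div_self (mul_ne_zero h3 (mass_insert_pos hu).ne')]

theorem IsHDX.sum_linkWalk_sq_le {ε : ℝ} (h : X.IsHDX ε) {σ : Finset V} (hσ : X.IsFace σ)
    (hσk : σ.card + 2 ≤ k) {f : V → ℝ}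
    (hf : ∑ v ∈ X.linkVertices σ, X.mass (insert v σ) * f v = 0) :
    ∑ u ∈ X.linkVertices σ, X.mass (insert u σ) *
        (∑ v ∈ X.linkVertices σ, X.linkWalk σ u v * f v) ^ 2 ≤
      ε ^ 2 * ∑ u ∈ X.linkVertices σ, X.mass (insert u σ) * f u ^ 2 := by
  have key := sum_mul_walk_sq_le (N := X.linkVertices σ) (m := fun v => X.mass (insert v.1 σ))
    (w := fun u v => X.linkWalk σ u v) (f := fun v => f v) (ε := ε)
    (fun v => mass_insert_pos v.2) ?_ ?_ ?_ ?_
  · have hin : ∀ u, ∑ v : X.linkVertices σ, X.linkWalk σ u v * f v =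
        ∑ v ∈ X.linkVertices σ, X.linkWalk σ u v * f v := fun u =>
      Finset.sum_coe_sort (X.linkVertices σ) fun v => X.linkWalk σ u v * f v
    simp only [hin] at key
    rwa [Finset.sum_coe_sort (X.linkVertices σ) fun u => X.mass (insert u σ) *
      (∑ v ∈ X.linkVertices σ, X.linkWalk σ u v * f v) ^ 2,
      Finset.sum_coe_sort (X.linkVertices σ) fun u => X.mass (insert u σ) * f u ^ 2] at key
  · intro u v
    have h1 := (mass_insert_pos u.2).ne'
    have h2 := (mass_insert_pos v.2).ne'
    simp only [linkWalk]
    by_cases huv : u.1 = v.1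
    · rw [if_pos huv, if_pos huv.symm, mul_zero, mul_zero]
    · rw [if_neg huv, if_neg (Ne.symm huv), Finset.insert_comm]
      field_simp
  · intro u
    exact (Finset.sum_coe_sort (X.linkVertices σ) fun v => X.linkWalk σ u v).trans
      (sum_linkWalk hσk u.2)
  · rintro r g ⟨v₀, hv₀⟩ hg0 hgr
    -- Extension by zero: the expansion hypothesis speaks of functions on all of `V` but only reads
    -- their values on the link.
    set G : V → ℝ := fun v => if hv : v ∈ X.linkVertices σ then g ⟨v, hv⟩ else 0 with hG
    have hGv : ∀ v : X.linkVertices σ, G v = g v := fun v => by simp [hG]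
    refine h σ hσ hσk r G ⟨⟨v₀, v₀.2, by rwa [hGv]⟩, ?_, fun u hu => ?_⟩
    · rw [← Finset.sum_coe_sort, ← hg0]
      exact Finset.sum_congr rfl fun v _ => by rw [hGv]
    · rw [← Finset.sum_coe_sort, hGv ⟨u, hu⟩, ← hgr ⟨u, hu⟩]
      exact Finset.sum_congr rfl fun v _ => by rw [hGv]
  · exact (Finset.sum_coe_sort (X.linkVertices σ) fun v => X.mass (insert v σ) * f v).trans hf

/-- A function of the vertices in the positions `R` and `j` is, given the vertices in the
positions `R`, a function of the vertex in position `j`. -/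
theorem exists_eq_comp_coord {R : Finset (Fin k)} {j : Fin k} {a : X.Ordered → ℝ}
    (ha : X.ordered.Dep (insert j R) a) (ω : X.Ordered) :
    ∃ α : V → ℝ, ∀ ω' ∈ X.ordered.fiber R ω, a ω' = α (X.ordered.coord ω' j) := by
  classical
  refine ⟨fun v => if h : ∃ ω' ∈ X.ordered.fiber R ω, X.ordered.coord ω' j = v
    then a h.choose else 0, fun ω' hω' => ?_⟩
  have h : ∃ ω'' ∈ X.ordered.fiber R ω, X.ordered.coord ω'' j = X.ordered.coord ω' j :=
    ⟨ω', hω', rfl⟩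
  simp only [dif_pos h]
  refine (ha ω' h.choose fun i hi => ?_).symm
  rcases Finset.mem_insert.1 hi with rfl | hi
  · exact h.choose_spec.2
  · rw [CoordinateSpace.mem_fiber.1 h.choose_spec.1 i hi, CoordinateSpace.mem_fiber.1 hω' i hi]

theorem cex_eq_sum_linkVertices {R : Finset (Fin k)} {j : Fin k} (hj : j ∉ R)
    {a : X.Ordered → ℝ} {ω : X.Ordered} {α : V → ℝ}
    (hα : ∀ ω' ∈ X.ordered.fiber R ω, a ω' = α (X.ordered.coord ω' j)) :
    X.ordered.cex R a ω =
      (∑ v ∈ X.linkVertices (vertices R ω), X.mass (insert v (vertices R ω)) * α v) /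
        (((k : ℝ) - R.card) * X.mass (vertices R ω)) := by
  rw [CoordinateSpace.cex_apply, Finset.sum_congr rfl fun ω' h => by rw [hα ω' h],
    sum_fiber_coord hj]
  have h1 := sum_fiber_coord hj ω fun _ => 1
  simp only [mul_one] at h1
  rw [h1, sum_mass_insert, mul_div_mul_left _ _ (by positivity), card_vertices]

/-- Given the vertices `σ` in positions `R`, a function of position `j` averaged given position `i`
is one step of the link walk of `σ`. After centring, the walk contracts by `ε`; this holds on every
fibre and is then integrated. -/
theorem IsHDX.pairwiseNearIndep {ε : ℝ} (hε : 0 ≤ ε) (h : X.IsHDX ε) :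
    X.ordered.PairwiseNearIndep ε := by
  intro R i j hi hj hij f
  set a := X.ordered.cex (insert j R) f with ha
  have hadep : X.ordered.Dep (insert j R) a := CoordinateSpace.dep_cex _ _
  have hRa : X.ordered.cex R f = X.ordered.cex R a :=
    (CoordinateSpace.cex_cex_of_superset (Finset.subset_insert j R) f).symm
  rw [hRa]
  have hcard : R.card + 2 ≤ k := by
    have h1 := Finset.card_le_univ (insert i (insert j R))
    rwa [Finset.card_insert_of_notMem (by simp [hi, hij]), Finset.card_insert_of_notMem hj,
      Fintype.card_fin] at h1
  have hcard' : (R.card : ℝ) + 2 ≤ k := by exact_mod_cast hcard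
  set b := X.ordered.cex (insert i R) a - X.ordered.cex R a with hb
  have hpt : ∀ ω, X.ordered.cex R (b ^ 2) ω ≤ X.ordered.cex R (ε ^ 2 • a ^ 2) ω := by
    intro ω
    obtain ⟨α, hα⟩ := exists_eq_comp_coord hadep ω
    set σ := vertices R ω with hσ
    have hσc : σ.card = R.card := card_vertices R ω
    set c := X.ordered.cex R a ω with hc
    have hcR := cex_eq_sum_linkVertices hj hα
    rw [← hc, ← hσ] at hcR
    have hσpos : 0 < X.mass σ := mass_pos ω.1.2 (vertices_subset R ω)
    have hmean : ∑ v ∈ X.linkVertices σ, X.mass (insert v σ) * (α v - c) = 0 := by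
      simp only [mul_sub]
      rw [Finset.sum_sub_distrib, ← Finset.sum_mul, sum_mass_insert, hcR, hσc]
      have : ((k : ℝ) - R.card) ≠ 0 := by linarith
      field_simp
      ring
    have hbω : ∀ ω' ∈ X.ordered.fiber R ω, b ω' =
        ∑ v ∈ X.linkVertices σ, X.linkWalk σ (X.ordered.coord ω' i) v * (α v - c) := by
      intro ω' hω'
      have hfib := CoordinateSpace.fiber_eq (CoordinateSpace.mem_fiber.1 hω')
      have hv : vertices R ω' = σ := vertices_congr (CoordinateSpace.mem_fiber.1 hω')
      have hu : X.ordered.coord ω' i ∈ X.linkVertices σ := by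
        rw [← hv]; exact coord_mem_linkVertices hi ω'
      have h1 : X.ordered.cex R a ω' = c :=
        CoordinateSpace.dep_cex R a ω ω' (CoordinateSpace.mem_fiber.1 hω')
      have h2 := cex_eq_sum_linkVertices (R := insert i R) (j := j)
        (by simp [hj, Ne.symm hij]) (a := a) (ω := ω') (α := α) fun ω'' hω'' => by
          refine hα ω'' ?_
          rw [← hfib, CoordinateSpace.mem_fiber]
          exact fun l hl => CoordinateSpace.mem_fiber.1 hω'' l (Finset.mem_insert_of_mem hl)
      rw [vertices_insert, hv, Finset.card_insert_of_notMem hi] at h2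
      rw [hb, Pi.sub_apply, h1, h2]
      simp only [mul_sub]
      rw [Finset.sum_sub_distrib, ← Finset.sum_mul, sum_linkWalk (hσc ▸ hcard) hu, one_mul,
        sum_linkWalk_mul, hσc]
      push_cast
      rw [sub_sub (k : ℝ)]
    have hspec := h.sum_linkWalk_sq_le (isFace_vertices R ω) (hσ ▸ hσc ▸ hcard) hmean
    -- The variance is at most the second moment.
    have hvar : ∑ v ∈ X.linkVertices σ, X.mass (insert v σ) * (α v - c) ^ 2 ≤
        ∑ v ∈ X.linkVertices σ, X.mass (insert v σ) * α v ^ 2 := by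
      have h1 : ∑ v ∈ X.linkVertices σ, X.mass (insert v σ) * α v ^ 2 =
          ∑ v ∈ X.linkVertices σ, X.mass (insert v σ) * (α v - c) ^ 2 +
          2 * c * ∑ v ∈ X.linkVertices σ, X.mass (insert v σ) * (α v - c) +
          c ^ 2 * ∑ v ∈ X.linkVertices σ, X.mass (insert v σ) := by
        rw [Finset.mul_sum, Finset.mul_sum, ← Finset.sum_add_distrib, ← Finset.sum_add_distrib]
        exact Finset.sum_congr rfl fun v _ => by ring
      rw [h1, hmean, mul_zero, add_zero]
      have := mul_nonneg (sq_nonneg c)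
        (Finset.sum_nonneg fun v (_ : v ∈ X.linkVertices σ) => mass_nonneg (X := X) (insert v σ))
      linarith
    rw [CoordinateSpace.cex_apply, CoordinateSpace.cex_apply]
    refine div_le_div_of_nonneg_right ?_ (CoordinateSpace.fiber_mass_pos R ω).le
    have h1 : ∀ ω' ∈ X.ordered.fiber R ω, X.ordered.prob ω' * (b ^ 2) ω' = X.ordered.prob ω' *
        (fun u => (∑ v ∈ X.linkVertices σ, X.linkWalk σ u v * (α v - c)) ^ 2)
          (X.ordered.coord ω' i) := fun ω' hω' => by
      rw [Pi.pow_apply, hbω ω' hω']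
    have h2 : ∀ ω' ∈ X.ordered.fiber R ω, X.ordered.prob ω' * (ε ^ 2 • a ^ 2) ω' =
        X.ordered.prob ω' * (fun u => ε ^ 2 * α u ^ 2) (X.ordered.coord ω' j) := fun ω' hω' => by
      rw [Pi.smul_apply, Pi.pow_apply, hα ω' hω', smul_eq_mul]
    rw [Finset.sum_congr rfl h1, Finset.sum_congr rfl h2, sum_fiber_coord hi ω (fun u =>
      (∑ v ∈ X.linkVertices σ, X.linkWalk σ u v * (α v - c)) ^ 2),
      sum_fiber_coord hj ω (fun u => ε ^ 2 * α u ^ 2)]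
    refine mul_le_mul_of_nonneg_left ?_ (by positivity)
    refine hspec.trans ((mul_le_mul_of_nonneg_left hvar (sq_nonneg ε)).trans (le_of_eq ?_))
    rw [Finset.mul_sum]
    exact Finset.sum_congr rfl fun v _ => by ring
  have h1 := CoordinateSpace.ex_mono (P := X.ordered) hpt
  rw [CoordinateSpace.ex_cex, CoordinateSpace.ex_cex, map_smul, smul_eq_mul,
    ← CoordinateSpace.nrm_sq, ← CoordinateSpace.nrm_sq, ← mul_pow] at h1
  have h2 := (pow_le_pow_iff_left₀ (CoordinateSpace.nrm_nonneg b)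
    (mul_nonneg hε (CoordinateSpace.nrm_nonneg a)) two_ne_zero).1 h1
  exact h2.trans (mul_le_mul_of_nonneg_left (CoordinateSpace.nrm_cex_le _ f) hε)

end WeightedComplex

/-! ### From loss of norm to a lower bound on the shadow. -/

namespace WeightedComplex

variable {V : Type*} [DecidableEq V] {k : ℕ} {X : WeightedComplex V k}

/-- The factor `k!` appears because the ordered space is not normalised. Empty `V` is separate: then
there need not be a function `Fin k → V` to serve as the vacuous prescription. -/
theorem ex_ordered (F : Finset V → ℝ) :
    X.ordered.ex (fun ω => F ω.1) = (k.factorial : ℝ) * ∑ τ ∈ X.facets, X.weight τ * F τ := by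
  rcases isEmpty_or_nonempty V with hV | ⟨⟨v₀⟩⟩
  · rcases isEmpty_or_nonempty X.Ordered with h | ⟨⟨ω⟩⟩
    · have h1 : X.facets = ∅ := Finset.eq_empty_of_forall_notMem fun τ hτ => h.false
        ⟨⟨τ, hτ⟩, (finCongr (by rw [Fintype.card_coe, card_of_mem_facets hτ])).trans
          (Fintype.equivFin τ).symm⟩
      simp [CoordinateSpace.ex_apply, h1]
    · have h1 := sum_fiber (X := X) ∅ ω F
      simpa [CoordinateSpace.fiber, vertices, CoordinateSpace.ex_apply] using h1
  · have h1 := sum_ordered_extending (X := X) ∅ (y := fun _ => v₀) (by simp) F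
    simpa [CoordinateSpace.ex_apply] using h1

theorem mass_of_mem_facets {τ : Finset V} (hτ : τ ∈ X.facets) : X.mass τ = X.weight τ := by
  rw [mass, Finset.sum_eq_single_of_mem τ (Finset.mem_filter.2 ⟨hτ, subset_rfl⟩)]
  intro τ' hτ' hne
  rw [Finset.mem_filter] at hτ'
  refine absurd (Finset.eq_of_subset_of_card_le hτ'.2 ?_).symm hne
  rw [card_of_mem_facets hτ, card_of_mem_facets hτ'.1]

theorem measure_nonneg (B : Finset (Finset V)) : 0 ≤ X.measure B :=
  Finset.sum_nonneg fun σ _ => div_nonneg (mass_nonneg σ) (Nat.cast_nonneg _)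

theorem measure_of_subset_facets {A : Finset (Finset V)} (hA : A ⊆ X.facets) :
    X.measure A = ∑ τ ∈ X.facets, X.weight τ * indicator A τ := by
  have h1 : ∀ τ ∈ A, X.mass τ / (k.choose τ.card : ℝ) = X.weight τ * indicator A τ :=
    fun τ hτ => by
      rw [mass_of_mem_facets (hA hτ), card_of_mem_facets (hA hτ), Nat.choose_self, indicator,
        if_pos hτ]
      simp
  rw [measure, Finset.sum_congr rfl h1, Finset.sum_subset hA]
  intro τ _ hτ
  rw [indicator, if_neg hτ, mul_zero]

theorem card_of_mem_shadow {A : Finset (Finset V)} (hA : A ⊆ X.facets) {σ : Finset V}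
    (hσ : σ ∈ A.shadow) : σ.card = k - 1 := by
  obtain ⟨τ, hτ, a, ha, rfl⟩ := Finset.mem_shadow_iff.1 hσ
  rw [Finset.card_erase_of_mem ha, card_of_mem_facets (hA hτ)]

theorem mul_measure_shadow (hk : 1 ≤ k) {A : Finset (Finset V)} (hA : A ⊆ X.facets) :
    (k : ℝ) * X.measure A.shadow = ∑ σ ∈ A.shadow, X.mass σ := by
  rw [measure, Finset.mul_sum]
  refine Finset.sum_congr rfl fun σ hσ => ?_
  have hk0 : (k : ℝ) ≠ 0 := by positivity
  rw [card_of_mem_shadow hA hσ, Nat.choose_symm hk, Nat.choose_one_right]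
  field_simp

theorem vertices_univ (ω : X.Ordered) : vertices Finset.univ ω = ω.1 :=
  Finset.eq_of_subset_of_card_le (vertices_subset _ ω)
    (by rw [card_vertices, Finset.card_univ, Fintype.card_fin, card_of_mem_facets ω.1.2])

theorem vertices_compl_singleton (i : Fin k) (ω : X.Ordered) :
    vertices {i}ᶜ ω = (ω.1 : Finset V).erase (X.ordered.coord ω i) := by
  rw [← vertices_univ ω, vertices, vertices, ← Finset.image_erase (coord_injective ω)]
  congr 1
  ext j; simp

/-- The family `B`, as a function of all the vertices but the one in position `i`. -/
def facetIndicator (X : WeightedComplex V k) (B : Finset (Finset V)) (i : Fin k) :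
    X.Ordered → ℝ := fun ω => indicator B (vertices {i}ᶜ ω)

theorem dep_facetIndicator (B : Finset (Finset V)) (i : Fin k) :
    X.ordered.Dep {i}ᶜ (X.facetIndicator B i) := fun ω ω' h => by
  rw [facetIndicator, facetIndicator, vertices_congr h]

/-- Different positions of an ordered facet give different faces on removal, so the positions
counted on the left inject into the members of `B` inside that facet. -/
theorem sum_nrm_facetIndicator_sq_le (B : Finset (Finset V)) :
    ∑ i, X.ordered.nrm (X.facetIndicator B i) ^ 2 ≤
      (k.factorial : ℝ) * ∑ σ ∈ B, X.mass σ := by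
  have h1 : ∀ i, X.ordered.nrm (X.facetIndicator B i) ^ 2 =
      X.ordered.ex (X.facetIndicator B i) := fun i => by
    rw [CoordinateSpace.nrm_sq]
    congr 1
    ext ω
    simp only [Pi.pow_apply, facetIndicator, indicator]
    split_ifs <;> simp
  have h2 : ∑ σ ∈ B, X.mass σ =
      ∑ τ ∈ X.facets, X.weight τ * ((B.filter (· ⊆ τ)).card : ℝ) := by
    simp only [mass]
    rw [Finset.sum_comm' (t' := X.facets) (s' := fun τ => B.filter (· ⊆ τ))]
    · refine Finset.sum_congr rfl fun τ _ => ?_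
      rw [Finset.sum_const, nsmul_eq_mul, mul_comm]
    · intro σ τ
      simp only [Finset.mem_filter]
      tauto
  rw [Finset.sum_congr rfl fun i _ => h1 i, h2,
    ← ex_ordered fun τ => ((B.filter (· ⊆ τ)).card : ℝ), ← map_sum]
  refine CoordinateSpace.ex_mono fun ω => ?_
  rw [Finset.sum_apply]
  simp only [facetIndicator, indicator]
  rw [Finset.sum_boole]
  refine Nat.cast_le.2 (Finset.card_le_card_of_injOn (fun i => vertices {i}ᶜ ω) ?_ ?_)
  · intro i hi
    rw [Finset.mem_coe, Finset.mem_filter] at hi ⊢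
    exact ⟨hi.2, vertices_subset _ ω⟩
  · intro i _ j _ hij
    have := Finset.image_injective (coord_injective ω) hij
    simpa using this

/-- On `A`, removing any vertex lands in the shadow, so `f` equals itself times the shadow indicator
at each `i`. Cauchy–Schwarz for each `i`, then over `i`, yields `(k · k! μ(A))² ≤ (k! · k μ(∂A)) (c
· k! μ(A))`. -/
theorem mul_measure_le_of_sum_nrm_cex_le (hk : 1 ≤ k) {A : Finset (Finset V)}
    (hA : A ⊆ X.facets) {c : ℝ}
    (h : ∑ i, X.ordered.nrm (X.ordered.cex {i}ᶜ fun ω => indicator A ω.1) ^ 2 ≤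
      c * X.ordered.nrm (fun ω => indicator A ω.1) ^ 2) :
    (k : ℝ) * X.measure A ≤ c * X.measure A.shadow := by
  set f : X.Ordered → ℝ := fun ω => indicator A ω.1 with hf
  have hk0 : (0 : ℝ) < k := by exact_mod_cast hk
  have hfac : (0 : ℝ) < k.factorial := by exact_mod_cast k.factorial_pos
  have hff : f ^ 2 = f := by
    ext ω; simp only [Pi.pow_apply, hf, indicator]; split_ifs <;> simp
  have hexf : X.ordered.ex f = k.factorial * X.measure A := by
    rw [measure_of_subset_facets hA, ← ex_ordered]
  rw [CoordinateSpace.nrm_sq, hff, hexf] at h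
  have h1 : ∀ i, X.ordered.ex f ≤
      X.ordered.nrm (X.facetIndicator A.shadow i) * X.ordered.nrm (X.ordered.cex {i}ᶜ f) := by
    intro i
    have h2 : f = X.facetIndicator A.shadow i * f := by
      ext ω
      simp only [Pi.mul_apply, hf, facetIndicator, indicator]
      by_cases hω : (ω.1 : Finset V) ∈ A
      · rw [if_pos hω, vertices_compl_singleton, if_pos, one_mul]
        exact Finset.mem_shadow_iff.2 ⟨ω.1, hω, _, (ω.2 i).2, rfl⟩
      · rw [if_neg hω, mul_zero]
    calc X.ordered.ex f = X.ordered.ex (X.facetIndicator A.shadow i * f) := by rw [← h2]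
      _ = X.ordered.ex (X.facetIndicator A.shadow i * X.ordered.cex {i}ᶜ f) :=
        (CoordinateSpace.ex_mul_cex (dep_facetIndicator _ i) f).symm
      _ ≤ _ := CoordinateSpace.ex_mul_le _ _
  have h2 := Finset.sum_le_sum fun i (_ : i ∈ Finset.univ) => h1 i
  rw [Finset.sum_const, Finset.card_univ, Fintype.card_fin, nsmul_eq_mul, hexf] at h2
  have h3 := Finset.sum_mul_sq_le_sq_mul_sq Finset.univ
    (fun i => X.ordered.nrm (X.facetIndicator A.shadow i))
    (fun i => X.ordered.nrm (X.ordered.cex {i}ᶜ f))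
  have hA0 := measure_nonneg (X := X) A
  have hB0 := measure_nonneg (X := X) A.shadow
  have h4 := pow_le_pow_left₀ (by positivity) h2 2
  have h5 := sum_nrm_facetIndicator_sq_le (X := X) A.shadow
  rw [← mul_measure_shadow hk hA] at h5
  have h6 : (0 : ℝ) ≤ ∑ i, X.ordered.nrm (X.ordered.cex {i}ᶜ f) ^ 2 :=
    Finset.sum_nonneg fun i _ => sq_nonneg _
  have h7 := (h4.trans h3).trans (mul_le_mul h5 h h6 (by positivity))
  -- Cancelling a factor `μ(A)` needs it nonzero; full support makes `A` empty otherwise.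
  rcases hA0.eq_or_lt with h0 | h0
  · have hAe : A = ∅ := by
      refine Finset.eq_empty_of_forall_notMem fun τ hτ => ?_
      have : 0 < X.measure A := by
        refine Finset.sum_pos' (fun σ _ => div_nonneg (mass_nonneg σ) (Nat.cast_nonneg _))
          ⟨τ, hτ, ?_⟩
        rw [mass_of_mem_facets (hA hτ), card_of_mem_facets (hA hτ), Nat.choose_self]
        simpa using X.weight_pos τ (hA hτ)
      exact this.ne h0
    rw [hAe]
    simp [measure]
  · have h8 : 0 < (k.factorial : ℝ) * k.factorial * k * X.measure A := by positivity
    refine le_of_mul_le_mul_left ?_ h8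
    linarith

theorem cex_indicator_eq_linkNorm_sq (Q : Finset (Fin k)) (ω : X.Ordered)
    (A : Finset (Finset V)) : X.ordered.cex Q (fun ω => indicator A ω.1) ω =
      X.linkNorm (indicator A) (vertices Q ω) ^ 2 := by
  have h1 : ∀ τ, indicator A τ ^ 2 = indicator A τ := fun τ => by
    rw [indicator]; split_ifs <;> simp
  rw [linkNorm, Real.sq_sqrt, cex_ordered]
  · simp only [h1]
  · refine Finset.sum_nonneg fun τ hτ => mul_nonneg (div_nonneg ?_ (mass_nonneg _)) (sq_nonneg _)
    exact (X.weight_pos τ (Finset.mem_filter.1 hτ).1).le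

/-- When `k ≤ d` globalness applies to facets themselves, and the indicator has norm `1` in the link
of a member of `A`. -/
theorem eq_empty_of_isGlobal {d : ℕ} (hd : k ≤ d) {δ : ℝ} (hδ : δ < 1)
    {A : Finset (Finset V)} (hA : A ⊆ X.facets) (h : X.IsGlobal d δ (indicator A)) : A = ∅ := by
  refine Finset.eq_empty_of_forall_notMem fun τ hτ => ?_
  have h1 := h τ (Or.inr (mem_faces_of_mem_facets (hA hτ)))
    ((card_of_mem_facets (hA hτ)).trans_le hd)
  have h2 : X.linkNorm (indicator A) τ = 1 := by
    have h3 : X.facets.filter (τ ⊆ ·) = {τ} := by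
      ext τ'
      rw [Finset.mem_filter, Finset.mem_singleton]
      constructor
      · rintro ⟨h4, h5⟩
        exact (Finset.eq_of_subset_of_card_le h5
          (by rw [card_of_mem_facets h4, card_of_mem_facets (hA hτ)])).symm
      · rintro rfl
        exact ⟨hA hτ, subset_rfl⟩
    rw [linkNorm, h3, Finset.sum_singleton, mass_of_mem_facets (hA hτ), indicator, if_pos hτ,
      div_self (X.weight_pos τ (hA hτ)).ne']
    simp
  linarith

theorem dep_univ_comp_facet (F : Finset V → ℝ) :
    X.ordered.Dep Finset.univ fun ω => F ω.1 := by
  intro ω ω' h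
  have h1 : vertices Finset.univ ω' = vertices Finset.univ ω := vertices_congr h
  rw [vertices_univ, vertices_univ] at h1
  simp only [h1]

end WeightedComplex

end

/-! ### Choice of `ε₀` and conclusion. -/

theorem mainTheorem5 (k : ℕ) (hk : 1 ≤ k) :
    ∃ ε₀ : ℝ, 0 < ε₀ ∧
      ∀ (V : Type*) [DecidableEq V] (X : WeightedComplex V k) (ε : ℝ), 0 < ε → ε ≤ ε₀ →
        X.IsHDX ε →
        ∀ (d : ℕ) (δ : ℝ), δ ≤ ((200 * (d : ℝ)) ^ d)⁻¹ →
        ∀ A : Finset (Finset V), A ⊆ X.facets →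
          X.IsGlobal d δ (WeightedComplex.indicator A) →
          X.measure A * (1 + (d : ℝ) / (2 * (k : ℝ))) ≤ X.measure A.shadow := by
  have hk0 : (0 : ℝ) < k := by exact_mod_cast hk
  -- The last division by `k ^ 2` pays for the passage from `ε` to the near-product error `k ^ 2 *
  -- ε`.
  refine ⟨((200 * (k : ℝ)) ^ k)⁻¹ / (65536 * (k : ℝ) ^ 4 * (2 ^ k) ^ 10) / (k : ℝ) ^ 2,
    by positivity, fun V _ X ε hε hε₀ hX d δ hδ A hA hglob => ?_⟩
  have hf01 : ∀ ω : X.Ordered, WeightedComplex.indicator A (ω.1 : Finset V) = 0 ∨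
      WeightedComplex.indicator A (ω.1 : Finset V) = 1 := fun ω => by
    rw [WeightedComplex.indicator]; split_ifs <;> simp
  -- For `d = 0` only `μ(A) ≤ μ(∂A)` is needed, and contractivity of conditional expectations
  -- suffices, with `c = k`.
  rcases Nat.eq_zero_or_pos d with rfl | hd
  · have h1 := WeightedComplex.mul_measure_le_of_sum_nrm_cex_le (c := k) hk hA (by
      refine (Finset.sum_le_card_nsmul Finset.univ _ _ fun i _ =>
        pow_le_pow_left₀ (CoordinateSpace.nrm_nonneg _)
          (CoordinateSpace.nrm_cex_le {i}ᶜ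
            fun ω : X.Ordered => WeightedComplex.indicator A ω.1) 2).trans ?_
      rw [Finset.card_univ, Fintype.card_fin, nsmul_eq_mul])
    have h2 := le_of_mul_le_mul_left h1 hk0
    simpa using h2
  have hd1 : (1 : ℝ) ≤ d := by exact_mod_cast hd
  rcases le_or_gt k d with hkd | hkd
  · have h1 : δ < 1 := hδ.trans_lt (inv_lt_one_of_one_lt₀ (one_lt_pow₀ (by linarith) hd.ne'))
    rw [WeightedComplex.eq_empty_of_isGlobal hkd h1 hA hglob]
    simp [WeightedComplex.measure]
  have hnear := (hX.pairwiseNearIndep hε.le).nearProduct hε.le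
  have hsum := CoordinateSpace.sum_nrm_cex_compl_sq_le_of_global (P := X.ordered)
    (f := fun ω => WeightedComplex.indicator A ω.1) (by positivity) hnear hd
    (by simpa using hkd) hf01
    (WeightedComplex.dep_univ_comp_facet _) (fun Q hQ ω => by
      rw [WeightedComplex.cex_indicator_eq_linkNorm_sq]
      refine pow_le_pow_left₀ (Real.sqrt_nonneg _)
        ((hglob _ (WeightedComplex.isFace_vertices Q ω) ?_).trans hδ) 2
      rwa [WeightedComplex.card_vertices])
    (by
      rw [le_div_iff₀ (by positivity)] at hε₀
      rw [Fintype.card_fin]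
      linarith)
  rw [Fintype.card_fin] at hsum
  have h1 := WeightedComplex.mul_measure_le_of_sum_nrm_cex_le hk hA hsum
  have hB0 := WeightedComplex.measure_nonneg (X := X) A.shadow
  have hdk : (d : ℝ) < k := by exact_mod_cast hkd
  have h2 : X.measure A ≤ ((k : ℝ) - d) * X.measure A.shadow / k := by
    rw [le_div_iff₀ hk0]; linarith
  -- The bound obtained is `k / (k - d)`, which exceeds `1 + d / (2k)` because `(k - d)(2k + d) =
  -- 2k² - kd - d²`.
  have h3 : ((k : ℝ) - d) / k * (1 + (d : ℝ) / (2 * k)) ≤ 1 := by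
    rw [show ((k : ℝ) - d) / k * (1 + (d : ℝ) / (2 * k)) =
      ((k - d) * (2 * k + d)) / (2 * k ^ 2) by field_simp, div_le_one (by positivity)]
    nlinarith
  calc X.measure A * (1 + (d : ℝ) / (2 * k)) ≤
      ((k : ℝ) - d) * X.measure A.shadow / k * (1 + (d : ℝ) / (2 * k)) := by gcongr
    _ = X.measure A.shadow * (((k : ℝ) - d) / k * (1 + (d : ℝ) / (2 * k))) := by ring
    _ ≤ X.measure A.shadow * 1 := by gcongr
    _ = _ := mul_one _
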